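/- Let $\mathcal A$ be an exact category in the sense of Quillen which is $\mathrm{Hom}$-finite (all sets $\mathrm{Hom}(X,Y)$ are finite). Let $\mathrm{Iso}\,\mathcal A$ be the monoid of isomorphism classes of objects under $[X]+[Y]=[X\oplus Y]$, let $(\mathrm{Iso}\,\mathcal A)^+=\mathrm{Iso}\,\mathcal A\setminus\{[0]\}$, and let $\mathrm{Ind}\,\mathcal A\subset \mathrm{Iso}\,\mathcal A$ be the set of classes of indecomposable objects. Write $\underline{\mathrm{Ext}}^1(A,B)$ for the set of all $[X]\in\mathrm{Iso}\,\mathcal A$ for which there is a short exact sequence $B\rightarrowtail X\twoheadrightarrow A$. The Grothendieck monoid $\Gamma$ is the quotient of $\mathrm{Iso}\,\mathcal A$ by the equivalence relation (which is a congruence) generated by $[X]\equiv[Y]$ whenever $[X],[Y]\in\underline{\mathrm{Ext}}^1(M,N)$ for some $M,N$; write $|X|$ for the image of $[X]$ in $\Gamma$. Assume that $\mathcal A$ is profinitary, i.e. $\{[X] : |X|=\gamma\}$ is finite for every $\gamma\in\Gamma$, and cofinitary, i.e. for every $[X]$ the set of pairs $([A],[B])$ with $[X]\in\underline{\mathrm{Ext}}^1(A,B)$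 is finite. Let $H_{\mathcal A}=\bigoplus_{[X]\in\mathrm{Iso}\,\mathcal A}\mathbb Q\,[X]$ be the Hall algebra, with product $[A]\cdot[B]=\sum_{[C]}F_{A,B}^C\,[C]$ and unit $1=[0]$, where $F_{A,B}^C$ is the number of $\mathrm{Aut}(A)\times\mathrm{Aut}(B)$-orbits in the set of short exact sequences $B\rightarrowtail C\twoheadrightarrow A$; with coproduct $\Delta([C])=\sum_{[A],[B]}F^{A,B}_C\,[A]\otimes[B]$, where $F^{A,B}_C=\frac{\#\mathrm{Aut}(A)\cdot\#\mathrm{Aut}(B)}{\#\mathrm{Aut}(C)}F_{B,A}^C$; and with counit $\varepsilon([C])=\delta_{[0],[C]}$. Put $$\mathrm{Prim}(H_{\mathcal A})=\{v\in H_{\mathcal A} : \Delta(v)=v\otimes1+1\otimes v\},$$ and for $\gamma\in\Gamma$ let $(H_{\mathcal A})_\gamma$ be the span of all $[X]$ with $|X|=\gamma$. For subspaces $V,W$ of $H_{\mathcal A}$, let $V\cdot W$ denote the span of all products $vw$ with $v\in V$, $w\in W$, and let $V^k$ denote the corresponding powers. Let $P=\ker\varepsilon\cdot\ker\varepsilon$,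 $P_\gamma=P\cap (H_{\mathcal A})_\gamma$ and $\mathrm{Prim}(H_{\mathcal A})_\gamma=\mathrm{Prim}(H_{\mathcal A})\cap(H_{\mathcal A})_\gamma$. Then: 1. $P$ is the $\mathbb Q$-span of $\{[M]\cdot[N] : [M],[N]\in(\mathrm{Iso}\,\mathcal A)^+\}$; 2. $P=\sum_{k\ge2}\mathrm{Prim}(H_{\mathcal A})^k=\sum_{k\ge2}(\mathbb Q\,\mathrm{Ind}\,\mathcal A)^k$, where $\mathbb Q\,\mathrm{Ind}\,\mathcal A$ is the span of $\mathrm{Ind}\,\mathcal A$ in $H_{\mathcal A}$; 3. $(H_{\mathcal A})_\gamma=\mathrm{Prim}(H_{\mathcal A})_\gamma\oplus P_\gamma$ for every $\gamma\in\Gamma\setminus\{0\}$. -/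

import Mathlib

open CategoryTheory CategoryTheory.Limits
open scoped ZeroObject TensorProduct

universe v u

set_option linter.unusedSectionVars false

/-! ### Isomorphism classes of objects -/

/-- `Iso C`: the isomorphism classes of objects of `C`. -/
def IsoClass (C : Type u) [Category.{v} C] : Type u :=
  Quotient (isIsomorphicSetoid C)

namespace IsoClass

variable {C : Type u} [Category.{v} C]

/-- The class `[X]` of an object `X`. -/
def mk (X : C) : IsoClass C := Quotient.mk (isIsomorphicSetoid C) X

theorem mk_eq_mk_iff {X Y : C} : mk X = mk Y ↔ Nonempty (X ≅ Y) :=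
  Quotient.eq (r := isIsomorphicSetoid C)

theorem exists_mk (x : IsoClass C) : ∃ X : C, mk X = x := Quotient.exists_rep x

variable [Preadditive C] [HasZeroObject C] [HasBinaryBiproducts C]

noncomputable instance : Zero (IsoClass C) := ⟨mk (0 : C)⟩

/-- `[X] + [Y] = [X ⊕ Y]`. -/
noncomputable instance : Add (IsoClass C) :=
  ⟨Quotient.map₂ (fun X Y : C => X ⊞ Y)
    (fun _ _ ⟨e⟩ _ _ ⟨f⟩ => ⟨biprod.mapIso e f⟩)⟩

theorem mk_add_mk (X Y : C) : mk X + mk Y = mk (X ⊞ Y) := rfl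

theorem zero_def : (0 : IsoClass C) = mk (0 : C) := rfl

theorem zero_add' (x : IsoClass C) : 0 + x = x := by
  obtain ⟨X, rfl⟩ := exists_mk x
  rw [zero_def, mk_add_mk, mk_eq_mk_iff]
  exact ⟨{ hom := biprod.snd
           inv := biprod.inr
           hom_inv_id := by ext; simp
           inv_hom_id := by simp }⟩

theorem add_comm' (x y : IsoClass C) : x + y = y + x := by
  obtain ⟨X, rfl⟩ := exists_mk x
  obtain ⟨Y, rfl⟩ := exists_mk y
  rw [mk_add_mk, mk_add_mk, mk_eq_mk_iff]
  exact ⟨biprod.braiding X Y⟩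

theorem add_assoc' (x y z : IsoClass C) : x + y + z = x + (y + z) := by
  obtain ⟨X, rfl⟩ := exists_mk x
  obtain ⟨Y, rfl⟩ := exists_mk y
  obtain ⟨Z, rfl⟩ := exists_mk z
  rw [mk_add_mk, mk_add_mk, mk_add_mk, mk_add_mk, mk_eq_mk_iff]
  exact ⟨biprod.associator X Y Z⟩

noncomputable instance : AddCommMonoid (IsoClass C) where
  add_assoc := add_assoc'
  zero_add := zero_add'
  add_zero x := by rw [add_comm', zero_add']
  add_comm := add_comm'
  nsmul := nsmulRec

end IsoClass

/-- `Ind C`: the isomorphism classes of indecomposable objects. -/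
def indClasses (C : Type u) [Category.{v} C] [Preadditive C] [HasBinaryBiproducts C] :
    Set (IsoClass C) :=
  {x | ∃ X : C, Indecomposable X ∧ IsoClass.mk X = x}

/-! ### Exact categories -/

section ExactStructureDef

variable (C : Type u) [Category.{v} C] [Preadditive C]

/-- A Quillen exact structure on an additive category `C`: a class of kernel-cokernel pairs
`X₁ ↣ X₂ ↠ X₃` ("conflations", "short exact sequences"), closed under isomorphism, such that
admissible monomorphisms and admissible epimorphisms contain the identities, are closed under
composition and are stable under pushout, respectively pullback, along arbitrary morphisms. -/
structure ExactStructure where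
  /-- The distinguished short exact sequences. -/
  conflation : ShortComplex C → Prop
  conflation_of_iso : ∀ {S T : ShortComplex C}, (S ≅ T) → conflation S → conflation T
  isKernel : ∀ {S : ShortComplex C}, conflation S →
    Nonempty (IsLimit (KernelFork.ofι S.f S.zero))
  isCokernel : ∀ {S : ShortComplex C}, conflation S →
    Nonempty (IsColimit (CokernelCofork.ofπ S.g S.zero))
  /-- Identities are admissible monomorphisms. -/
  id_mono : ∀ X : C, ∃ (Z : C) (g : X ⟶ Z) (w : 𝟙 X ≫ g = 0), conflation (.mk (𝟙 X) g w)
  /-- Identities are admissible epimorphisms. -/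
  id_epi : ∀ X : C, ∃ (K : C) (f : K ⟶ X) (w : f ≫ 𝟙 X = 0), conflation (.mk f (𝟙 X) w)
  /-- Admissible monomorphisms are closed under composition. -/
  comp_mono : ∀ {X Y Z : C} (i : X ⟶ Y) (j : Y ⟶ Z),
    (∃ (W : C) (g : Y ⟶ W) (w : i ≫ g = 0), conflation (.mk i g w)) →
    (∃ (W : C) (g : Z ⟶ W) (w : j ≫ g = 0), conflation (.mk j g w)) →
    ∃ (W : C) (g : Z ⟶ W) (w : (i ≫ j) ≫ g = 0), conflation (.mk (i ≫ j) g w)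
  /-- Admissible epimorphisms are closed under composition. -/
  comp_epi : ∀ {X Y Z : C} (p : X ⟶ Y) (q : Y ⟶ Z),
    (∃ (K : C) (f : K ⟶ X) (w : f ≫ p = 0), conflation (.mk f p w)) →
    (∃ (K : C) (f : K ⟶ Y) (w : f ≫ q = 0), conflation (.mk f q w)) →
    ∃ (K : C) (f : K ⟶ X) (w : f ≫ p ≫ q = 0), conflation (.mk f (p ≫ q) w)
  /-- Admissible monomorphisms have pushouts, which are again admissible monomorphisms. -/
  pushout_mono : ∀ {X Y X' : C} (i : X ⟶ Y) (h : X ⟶ X'),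
    (∃ (W : C) (g : Y ⟶ W) (w : i ≫ g = 0), conflation (.mk i g w)) →
    ∃ (Y' : C) (h' : Y ⟶ Y') (i' : X' ⟶ Y'), IsPushout i h h' i' ∧
      ∃ (W : C) (g : Y' ⟶ W) (w : i' ≫ g = 0), conflation (.mk i' g w)
  /-- Admissible epimorphisms have pullbacks, which are again admissible epimorphisms. -/
  pullback_epi : ∀ {X Y Y' : C} (p : X ⟶ Y) (h : Y' ⟶ Y),
    (∃ (K : C) (f : K ⟶ X) (w : f ≫ p = 0), conflation (.mk f p w)) →
    ∃ (X' : C) (h' : X' ⟶ X) (p' : X' ⟶ Y'), IsPullback h' p' p h ∧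
      ∃ (K : C) (f : K ⟶ X') (w : f ≫ p' = 0), conflation (.mk f p' w)

end ExactStructureDef

namespace ExactStructure

variable {C : Type u} [Category.{v} C] [Preadditive C]

/-- `Ext¹(a, b)` as a set of isomorphism classes: those `[X]` for which there is a short exact
sequence `B ↣ X ↠ A` with `[A] = a` and `[B] = b`. -/
def extClasses (E : ExactStructure C) (a b : IsoClass C) : Set (IsoClass C) :=
  {x | ∃ S : ShortComplex C, E.conflation S ∧
    IsoClass.mk S.X₁ = b ∧ IsoClass.mk S.X₂ = x ∧ IsoClass.mk S.X₃ = a}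

/-! ### The Grothendieck monoid -/

/-- `x` and `y` are both middle terms of short exact sequences with the same end terms. -/
def extRel (E : ExactStructure C) (x y : IsoClass C) : Prop :=
  ∃ a b : IsoClass C, x ∈ E.extClasses a b ∧ y ∈ E.extClasses a b

theorem extRel_symm (E : ExactStructure C) {x y : IsoClass C} (h : E.extRel x y) :
    E.extRel y x := by
  obtain ⟨a, b, hx, hy⟩ := h
  exact ⟨a, b, hy, hx⟩

section Monoid

variable [HasZeroObject C] [HasBinaryBiproducts C]

/-- From `B ↣ X ↠ A` one gets `B ↣ X ⊕ Z ↠ A ⊕ Z`. -/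
theorem extClasses_add (E : ExactStructure C) {a b x : IsoClass C}
    (h : x ∈ E.extClasses a b) (z : IsoClass C) : x + z ∈ E.extClasses (a + z) b := by
  obtain ⟨S, hS, rfl, rfl, rfl⟩ := h
  obtain ⟨Z, rfl⟩ := IsoClass.exists_mk z
  obtain ⟨P, h', p', hP, K, f, w, hf⟩ :=
    E.pullback_epi S.g (biprod.fst : S.X₃ ⊞ Z ⟶ S.X₃) ⟨S.X₁, S.f, S.zero, hS⟩
  obtain ⟨hk⟩ := E.isKernel hS
  obtain ⟨hk'⟩ := E.isKernel hf
  have hQ : IsPullback (biprod.fst : S.X₂ ⊞ Z ⟶ S.X₂) (biprod.map S.g (𝟙 Z)) S.g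
      (biprod.fst : S.X₃ ⊞ Z ⟶ S.X₃) := by
    refine ⟨⟨by simp⟩, ⟨PullbackCone.IsLimit.mk _ (fun s => biprod.lift s.fst (s.snd ≫ biprod.snd))
      (fun s => by simp) (fun s => ?_) (fun s m h₁ h₂ => ?_)⟩⟩
    · ext
      · simpa using s.condition
      · simp
    · ext
      · simpa using h₁
      · simpa using congrArg (fun t => t ≫ biprod.snd) h₂
  have hmono : Mono S.f := ⟨fun u v huv => Fork.IsLimit.hom_ext hk huv⟩
  have hmono' : Mono f := ⟨fun u v huv => Fork.IsLimit.hom_ext hk' huv⟩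
  have w₁ : (f ≫ h') ≫ S.g = 0 := by
    rw [Category.assoc, hP.w, ← Category.assoc, show f ≫ p' = 0 from w, zero_comp]
  have w₂ : S.f ≫ S.g = (0 : S.X₁ ⟶ S.X₃ ⊞ Z) ≫ biprod.fst := by simp
  obtain ⟨α, hα⟩ : ∃ α : K ⟶ S.X₁, α ≫ S.f = f ≫ h' :=
    ⟨hk.lift (KernelFork.ofι _ w₁), hk.fac (KernelFork.ofι _ w₁) WalkingParallelPair.zero⟩
  have w₃ : hP.lift S.f 0 w₂ ≫ p' = 0 := by simp
  obtain ⟨β, hβ⟩ : ∃ β : S.X₁ ⟶ K, β ≫ f = hP.lift S.f 0 w₂ :=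
    ⟨hk'.lift (KernelFork.ofι _ w₃), hk'.fac (KernelFork.ofι _ w₃) WalkingParallelPair.zero⟩
  refine ⟨_, hf, IsoClass.mk_eq_mk_iff.2 ⟨⟨α, β, ?_, ?_⟩⟩,
    IsoClass.mk_eq_mk_iff.2 ⟨hP.isoIsPullback _ _ hQ⟩, rfl⟩
  · rw [← cancel_mono f]
    apply hP.hom_ext
    · simp [hβ, hα]
    · have w' : f ≫ p' = 0 := w
      simp [hβ, w']
  · rw [← cancel_mono S.f, Category.assoc, hα, ← Category.assoc, hβ]
    simp

theorem extRel_add (E : ExactStructure C) {x y : IsoClass C} (h : E.extRel x y)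
    (z : IsoClass C) : E.extRel (x + z) (y + z) := by
  obtain ⟨a, b, hx, hy⟩ := h
  exact ⟨a + z, b, E.extClasses_add hx z, E.extClasses_add hy z⟩

/-- The congruence `≡` on `Iso C`: the equivalence relation generated by `extRel`. -/
noncomputable def grothendieckCon (E : ExactStructure C) : AddCon (IsoClass C) where
  r := Relation.EqvGen E.extRel
  iseqv := Relation.EqvGen.is_equivalence _
  add' := by
    have key : ∀ {x y : IsoClass C}, Relation.EqvGen E.extRel x y →
        ∀ z, Relation.EqvGen E.extRel (x + z) (y + z) := by
      intro x y h z
      induction h with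
      | rel _ _ h => exact .rel _ _ (E.extRel_add h z)
      | refl _ => exact .refl _
      | symm _ _ _ ih => exact .symm _ _ ih
      | trans _ _ _ _ _ ih₁ ih₂ => exact .trans _ _ _ ih₁ ih₂
    intro w x y z h₁ h₂
    refine .trans _ _ _ (key h₁ y) ?_
    rw [add_comm x y, add_comm x z]
    exact key h₂ x

/-- The Grothendieck monoid `Γ` of an exact category. -/
noncomputable abbrev GrothendieckMonoid (E : ExactStructure C) : Type u := E.grothendieckCon.Quotient

/-- The canonical homomorphism `[X] ↦ |X|` from `Iso C` to `Γ`. -/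
noncomputable def grothendieckClass (E : ExactStructure C) : IsoClass C →+ E.GrothendieckMonoid :=
  E.grothendieckCon.mk'

/-! ### Finiteness conditions -/

/-- A Hom-finite exact category is finitary if every set `Ext¹(a, b)` of isomorphism classes
is finite. -/
structure IsFinitary (E : ExactStructure C) : Prop where
  finite_hom : ∀ X Y : C, Finite (X ⟶ Y)
  finite_ext : ∀ a b : IsoClass C, (E.extClasses a b).Finite

/-- A Hom-finite exact category is profinitary if every Grothendieck class is finite. -/
structure IsProfinitary (E : ExactStructure C) : Prop where
  finite_hom : ∀ X Y : C, Finite (X ⟶ Y)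
  finite_class : ∀ γ : E.GrothendieckMonoid,
    {x : IsoClass C | E.grothendieckClass x = γ}.Finite

/-- A Hom-finite exact category is cofinitary if every object is an extension of only finitely
many pairs of objects, up to isomorphism. -/
structure IsCofinitary (E : ExactStructure C) : Prop where
  finite_hom : ∀ X Y : C, Finite (X ⟶ Y)
  finite_coext : ∀ x : IsoClass C,
    {p : IsoClass C × IsoClass C | x ∈ E.extClasses p.1 p.2}.Finite

theorem IsProfinitary.isFinitary {E : ExactStructure C} (h : E.IsProfinitary) :
    E.IsFinitary where
  finite_hom := h.finite_hom
  finite_ext a b := by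
    rcases (E.extClasses a b).eq_empty_or_nonempty with h0 | ⟨x, hx⟩
    · rw [h0]; exact Set.finite_empty
    · refine (h.finite_class (E.grothendieckClass x)).subset fun y hy => ?_
      exact (AddCon.eq _).2 (.rel _ _ ⟨a, b, hy, hx⟩)

end Monoid

/-! ### Hall numbers -/

/-- The set `𝓔(A, B)_X` of all short exact sequences `B ↣ X ↠ A`. -/
def SES (E : ExactStructure C) (A B X : C) : Type v :=
  {p : (B ⟶ X) × (X ⟶ A) // ∃ w : p.1 ≫ p.2 = 0, E.conflation (.mk p.1 p.2 w)}

/-- Transport of short exact sequences along isomorphisms of the three objects. -/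
def SES.map (E : ExactStructure C) {A A' B B' X X' : C} (e : A ≅ A') (f : B ≅ B') (g : X ≅ X')
    (p : E.SES A B X) : E.SES A' B' X' :=
  ⟨(f.inv ≫ p.1.1 ≫ g.hom, g.inv ≫ p.1.2 ≫ e.hom), by
    obtain ⟨⟨i, q⟩, w, h⟩ := p
    have w' : i ≫ q = 0 := w
    refine ⟨by simp [reassoc_of% w'], E.conflation_of_iso ?_ h⟩
    exact ShortComplex.isoMk f g e (by simp) (by simp)⟩

/-- The action `(ψ, φ) • (f, g) = (f φ⁻¹, ψ g)` of `Aut A × Aut B` on `𝓔(A, B)_X`. -/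
instance (E : ExactStructure C) (A B X : C) : MulAction (Aut A × Aut B) (E.SES A B X) where
  smul s p := SES.map E s.1 s.2 (Iso.refl X) p
  one_smul p := by
    apply Subtype.ext
    change (_, _) = _
    ext
    · change (𝟙 B) ≫ p.1.1 ≫ 𝟙 X = _
      simp
    · change (𝟙 X) ≫ p.1.2 ≫ 𝟙 A = _
      simp
  mul_smul s t p := by
    apply Subtype.ext
    change (_, _) = (_, _)
    congr 1
    · change (s.2.inv ≫ t.2.inv) ≫ p.1.1 ≫ 𝟙 X = s.2.inv ≫ (t.2.inv ≫ p.1.1 ≫ 𝟙 X) ≫ 𝟙 X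
      simp
    · change 𝟙 X ≫ p.1.2 ≫ (t.1.hom ≫ s.1.hom) = 𝟙 X ≫ (𝟙 X ≫ p.1.2 ≫ t.1.hom) ≫ s.1.hom
      simp

/-- The number of `Aut A × Aut B`-orbits in `𝓔(A, B)_X`. -/
noncomputable def orbitCount (E : ExactStructure C) (A B X : C) : ℕ :=
  Nat.card (MulAction.orbitRel.Quotient (Aut A × Aut B) (E.SES A B X))

theorem orbitCount_congr (E : ExactStructure C) {A A' B B' X X' : C}
    (e : A ≅ A') (f : B ≅ B') (g : X ≅ X') : E.orbitCount A B X = E.orbitCount A' B' X' := by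
  have h₁ : ∀ p : E.SES A B X,
      SES.map E e.symm f.symm g.symm (SES.map E e f g p) = p := by
    intro p
    apply Subtype.ext
    apply Prod.ext <;> simp [SES.map]
  have h₂ : ∀ p : E.SES A' B' X',
      SES.map E e f g (SES.map E e.symm f.symm g.symm p) = p := by
    intro p
    apply Subtype.ext
    apply Prod.ext <;> simp [SES.map]
  refine Nat.card_congr (Quotient.congr ⟨SES.map E e f g, SES.map E e.symm f.symm g.symm, h₁, h₂⟩ ?_)
  intro p q
  change p ∈ MulAction.orbit (Aut A × Aut B) q ↔
    SES.map E e f g p ∈ MulAction.orbit (Aut A' × Aut B') (SES.map E e f g q)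
  constructor
  · rintro ⟨⟨s, t⟩, rfl⟩
    let s' : A ≅ A := s
    let t' : B ≅ B := t
    refine ⟨(e.symm ≪≫ s' ≪≫ e, f.symm ≪≫ t' ≪≫ f), ?_⟩
    change SES.map E _ _ (Iso.refl X') _ = SES.map E _ _ _ (SES.map E s' t' (Iso.refl X) _)
    apply Subtype.ext
    apply Prod.ext <;> simp [SES.map]
  · rintro ⟨⟨s, t⟩, hst⟩
    let s' : A' ≅ A' := s
    let t' : B' ≅ B' := t
    refine ⟨(e ≪≫ s' ≪≫ e.symm, f ≪≫ t' ≪≫ f.symm), ?_⟩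
    rw [← h₁ p, ← hst]
    change SES.map E _ _ (Iso.refl X) _ = SES.map E _ _ _ (SES.map E s' t' (Iso.refl X') _)
    apply Subtype.ext
    apply Prod.ext <;> simp [SES.map]

/-- The Hall number `F_{a,b}^x`, as a function of isomorphism classes. -/
noncomputable def hallNumber (E : ExactStructure C) (a b x : IsoClass C) : ℕ :=
  Quotient.liftOn x
    (fun X => Quotient.liftOn₂ a b (fun A B => E.orbitCount A B X)
      (fun _ _ _ _ ⟨e⟩ ⟨f⟩ => E.orbitCount_congr e f (Iso.refl X)))
    (by
      rintro X X' ⟨g⟩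
      induction a using Quotient.inductionOn
      induction b using Quotient.inductionOn
      exact E.orbitCount_congr (Iso.refl _) (Iso.refl _) g)

theorem hallNumber_mk (E : ExactStructure C) (A B X : C) :
    E.hallNumber (.mk A) (.mk B) (.mk X) = E.orbitCount A B X := rfl

theorem mem_extClasses_of_hallNumber_ne_zero (E : ExactStructure C) {a b x : IsoClass C}
    (h : E.hallNumber a b x ≠ 0) : x ∈ E.extClasses a b := by
  obtain ⟨A, rfl⟩ := IsoClass.exists_mk a
  obtain ⟨B, rfl⟩ := IsoClass.exists_mk b
  obtain ⟨X, rfl⟩ := IsoClass.exists_mk x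
  rw [hallNumber_mk] at h
  obtain ⟨⟨⟨⟨_, w, hp⟩⟩⟩, -⟩ := Nat.card_ne_zero.1 h
  exact ⟨_, hp, rfl, rfl, rfl⟩

end ExactStructure

/-- The number of automorphisms of an object in a given isomorphism class. -/
noncomputable def IsoClass.autCard {C : Type u} [Category.{v} C] (x : IsoClass C) : ℕ :=
  Quotient.liftOn x (fun X => Nat.card (Aut X))
    (fun _ _ ⟨e⟩ => Nat.card_congr (Aut.autMulEquivOfIso e).toEquiv)

namespace ExactStructure

variable {C : Type u} [Category.{v} C] [Preadditive C]

/-- The dual Hall number `F^{a,b}_c = (#Aut a · #Aut b / #Aut c) · F_{b,a}^c`. -/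
noncomputable def dualHallNumber (E : ExactStructure C) (a b c : IsoClass C) : ℚ :=
  ((a.autCard * b.autCard : ℕ) : ℚ) / (c.autCard : ℚ) * (E.hallNumber b a c : ℚ)

/-! ### The Hall algebra -/

/-- The underlying vector space `H = ℚ Iso C` of the Hall algebra. -/
abbrev HallAlgebra (C : Type u) [Category.{v} C] : Type u := IsoClass C →₀ ℚ

/-- The basis vector `[X]` of the Hall algebra. -/
noncomputable abbrev hallBasis (x : IsoClass C) : HallAlgebra C := Finsupp.single x 1

variable [HasZeroObject C] [HasBinaryBiproducts C] {E : ExactStructure C}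

/-- `[A] · [B] = ∑ F_{A,B}^X [X]`. -/
noncomputable def IsFinitary.basisMul (h : E.IsFinitary) (a b : IsoClass C) : HallAlgebra C :=
  Finsupp.ofSupportFinite (fun x => (E.hallNumber a b x : ℚ))
    ((h.finite_ext a b).subset fun _ hx =>
      E.mem_extClasses_of_hallNumber_ne_zero (Nat.cast_ne_zero.1 hx))

/-- The product of the Hall algebra, as a bilinear map. -/
noncomputable def IsFinitary.mul (h : E.IsFinitary) :
    HallAlgebra C →ₗ[ℚ] HallAlgebra C →ₗ[ℚ] HallAlgebra C :=
  Finsupp.linearCombination ℚ fun a => Finsupp.linearCombination ℚ fun b => h.basisMul a b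

/-- The powers of a subspace `V` of the Hall algebra: `V⁰ = ℚ · 1` and `Vᵏ⁺¹ = Vᵏ · V`, where
the product of two subspaces is the span of all products of their elements. -/
noncomputable def IsFinitary.pow (h : E.IsFinitary) (V : Submodule ℚ (HallAlgebra C)) :
    ℕ → Submodule ℚ (HallAlgebra C)
  | 0 => Submodule.span ℚ {hallBasis 0}
  | k + 1 => Submodule.map₂ h.mul (IsFinitary.pow h V k) V

/-- The coefficients `F^{a,b}_c` of `Δ([C])`, a finitely supported function of `(a, b)`. -/
noncomputable def IsCofinitary.coeff (h : E.IsCofinitary) (c : IsoClass C) :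
    IsoClass C × IsoClass C →₀ ℚ :=
  Finsupp.ofSupportFinite (fun p => E.dualHallNumber p.1 p.2 c)
    (((h.finite_coext c).image Prod.swap).subset fun p hp =>
      ⟨p.swap, E.mem_extClasses_of_hallNumber_ne_zero
        (Nat.cast_ne_zero.1 (right_ne_zero_of_mul hp)), Prod.swap_swap p⟩)

/-- The coproduct `Δ([C]) = ∑ F^{A,B}_C [A] ⊗ [B]`. -/
noncomputable def IsCofinitary.comul (h : E.IsCofinitary) :
    HallAlgebra C →ₗ[ℚ] HallAlgebra C ⊗[ℚ] HallAlgebra C :=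
  Finsupp.linearCombination ℚ fun c =>
    (h.coeff c).sum fun p r => r • (hallBasis p.1 ⊗ₜ[ℚ] hallBasis p.2)

/-- The counit `ε([C]) = δ_{[0],[C]}`. -/
noncomputable def counit : HallAlgebra C →ₗ[ℚ] ℚ := Finsupp.lapply 0

/-- The space of primitive elements: `Δ(v) = v ⊗ 1 + 1 ⊗ v`. -/
noncomputable def IsCofinitary.prim (h : E.IsCofinitary) : Submodule ℚ (HallAlgebra C) where
  carrier := {v | h.comul v = v ⊗ₜ[ℚ] hallBasis 0 + hallBasis 0 ⊗ₜ[ℚ] v}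
  add_mem' {v w} hv hw := by
    simp only [Set.mem_ofPred_eq] at *
    rw [map_add, hv, hw, TensorProduct.add_tmul, TensorProduct.tmul_add]
    abel
  zero_mem' := by simp
  smul_mem' r v hv := by
    simp only [Set.mem_ofPred_eq] at *
    rw [map_smul, hv, smul_add, TensorProduct.smul_tmul', TensorProduct.tmul_smul]

/-- The homogeneous component `H_γ`, spanned by the classes `[X]` with `|X| = γ`. -/
noncomputable def homogeneous (E : ExactStructure C) (γ : E.GrothendieckMonoid) :
    Submodule ℚ (HallAlgebra C) :=
  Submodule.span ℚ (hallBasis '' {x | E.grothendieckClass x = γ})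

/-- The subspace `P = ker ε · ker ε`. -/
noncomputable def IsFinitary.decomposables (h : E.IsFinitary) : Submodule ℚ (HallAlgebra C) :=
  Submodule.map₂ h.mul (LinearMap.ker counit) (LinearMap.ker counit)

/-- The subspace `ℚ Ind C`. -/
noncomputable def indSpan (C : Type u) [Category.{v} C] [Preadditive C]
    [HasBinaryBiproducts C] : Submodule ℚ (HallAlgebra C) :=
  Submodule.span ℚ (hallBasis '' indClasses C)

end ExactStructure

/-! Green's form, for which the classes are orthogonal with
$\langle[A],[A]\rangle=1/\#\mathrm{Aut}(A)$, turns the coproduct into the adjoint of the product,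
with the two factors interchanged (`IsCofinitary.comul_apply`). Hence $v$ is primitive exactly when
$\varepsilon(v)=0$ and $v$ is orthogonal to every $[M]\cdot[N]$ with $M,N\ne0$, that is, to $P$
(`IsCofinitary.mem_prim_iff`). No compatibility between product and coproduct is needed. The form is
positive definite, so $\mathrm{Prim}\cap P=0$. By profinitarity $H_\gamma$ is finite-dimensional, so
orthogonal projection to the products of degree $\gamma$ exists there, and its remainder is
primitive when $\gamma\ne0$ (`homogeneous_le_prim_sup`).

For the sums of powers it suffices that a subspace of $\ker\varepsilon$ generates $\ker\varepsilon$
under products (`IsFinitary.decomposables_eq_powersFrom_two`). This uses associativity, which comes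
from a weighted count of two-step flags (`sum_hallNumber_mul`). Generation is an induction on
$\#\mathrm{End}$, which grows when a nonzero summand is added and is strictly smaller for a nonsplit
extension than for the direct sum (`eq_add_or_endCard_lt`). Thus $[M]\cdot[N]$ is a nonzero multiple
of $[M\oplus N]$ plus smaller terms, which handles the indecomposables. For the primitives, the same
induction runs over Grothendieck classes, with the orthogonal decomposition as its step. -/

namespace ExactStructure

/-! ### Pullbacks and pushouts of conflations -/

section Conflations

variable {C : Type u} [Category.{v} C] [Preadditive C] (E : ExactStructure C)

theorem mono_of_conflation {A B X : C} {i : B ⟶ X} {q : X ⟶ A} {w : i ≫ q = 0}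
    (h : E.conflation (.mk i q w)) : Mono i := by
  obtain ⟨hk⟩ := E.isKernel h
  exact ⟨fun u v huv => Fork.IsLimit.hom_ext hk huv⟩

theorem epi_of_conflation {A B X : C} {i : B ⟶ X} {q : X ⟶ A} {w : i ≫ q = 0}
    (h : E.conflation (.mk i q w)) : Epi q := by
  obtain ⟨hk⟩ := E.isCokernel h
  exact ⟨fun u v huv => Cofork.IsColimit.hom_ext hk huv⟩

theorem exists_lift {A B X T : C} {i : B ⟶ X} {q : X ⟶ A} {w : i ≫ q = 0}
    (h : E.conflation (.mk i q w)) (t : T ⟶ X) (ht : t ≫ q = 0) : ∃ s : T ⟶ B, s ≫ i = t := by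
  obtain ⟨hk⟩ := E.isKernel h
  exact ⟨_, (KernelFork.IsLimit.lift' hk t ht).2⟩

theorem exists_desc {A B X T : C} {i : B ⟶ X} {q : X ⟶ A} {w : i ≫ q = 0}
    (h : E.conflation (.mk i q w)) (t : X ⟶ T) (ht : i ≫ t = 0) : ∃ s : A ⟶ T, q ≫ s = t := by
  obtain ⟨hk⟩ := E.isCokernel h
  exact ⟨_, (CokernelCofork.IsColimit.desc' hk t ht).2⟩

theorem conflation_of_isos {A A' B B' X X' : C} {i : B ⟶ X} {q : X ⟶ A} {w : i ≫ q = 0}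
    {i' : B' ⟶ X'} {q' : X' ⟶ A'} {w' : i' ≫ q' = 0} (h : E.conflation (.mk i q w))
    (α : B ≅ B') (β : X ≅ X') (γ : A ≅ A') (h₁ : α.hom ≫ i' = i ≫ β.hom)
    (h₂ : β.hom ≫ q' = q ≫ γ.hom) : E.conflation (.mk i' q' w') := by
  have e : ShortComplex.mk i q w ≅ ShortComplex.mk i' q' w' := ShortComplex.isoMk α β γ h₁ h₂
  exact E.conflation_of_iso e h

/-- Replace the kernel in a conflation by another monomorphism with the same image. -/
theorem conflation_of_mono {A B B' X : C} {i : B ⟶ X} {q : X ⟶ A} {w : i ≫ q = 0}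
    (h : E.conflation (.mk i q w)) (j : B' ⟶ X) [Mono j] (w' : j ≫ q = 0)
    (β : B ⟶ B') (hβ : β ≫ j = i) : E.conflation (.mk j q w') := by
  have := E.mono_of_conflation h
  obtain ⟨α, hα⟩ := E.exists_lift h j w'
  let e : B ≅ B' := ⟨β, α, by rw [← cancel_mono i]; simp [hα, hβ],
    by rw [← cancel_mono j]; simp [hα, hβ]⟩
  exact E.conflation_of_isos h e (Iso.refl _) (Iso.refl _) (by simp [e, hβ]) (by simp)

/-- Replace the cokernel in a conflation by another epimorphism with the same coimage. -/
theorem conflation_of_epi {A A' B X : C} {i : B ⟶ X} {q : X ⟶ A} {w : i ≫ q = 0}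
    (h : E.conflation (.mk i q w)) (r : X ⟶ A') [Epi r] (w' : i ≫ r = 0)
    (β : A' ⟶ A) (hβ : r ≫ β = q) : E.conflation (.mk i r w') := by
  have := E.epi_of_conflation h
  obtain ⟨α, hα⟩ := E.exists_desc h r w'
  let e : A ≅ A' := ⟨α, β, by rw [← cancel_epi q]; simp [reassoc_of% hα, hβ],
    by rw [← cancel_epi r]; simp [hα, reassoc_of% hβ]⟩
  exact E.conflation_of_isos h (Iso.refl _) (Iso.refl _) e (by simp) (by simp [e, hα])

variable {A B D X X' Y : C} {i : D ⟶ Y} {p : Y ⟶ X} {b : B ⟶ X} {a : X ⟶ A}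
  {j : X' ⟶ Y} {q : Y ⟶ A} {d : D ⟶ X'} {e : X' ⟶ B}

/-- A morphism into `Y` whose image in `X` factors through `B` is killed by `q = p ≫ a`, so it
factors through the kernel `j` of `q`. In terms of subobjects, `X'` is the preimage of `B` in `Y`.
-/
theorem isPullback_of_conflation {w₁ : b ≫ a = 0} {w₂ : j ≫ q = 0}
    (h₁ : E.conflation (.mk b a w₁)) (h₂ : E.conflation (.mk j q w₂))
    (hq : p ≫ a = q) (hsq : j ≫ p = e ≫ b) : IsPullback j e p b := by
  have := E.mono_of_conflation h₁
  have := E.mono_of_conflation h₂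
  have key : ∀ s : PullbackCone p b, ∃ l : s.pt ⟶ X', l ≫ j = s.fst := fun s =>
    E.exists_lift h₂ s.fst (by rw [← hq, reassoc_of% s.condition, w₁, comp_zero])
  choose l hl using key
  refine ⟨⟨hsq⟩, ⟨PullbackCone.IsLimit.mk _ l hl (fun s => ?_) fun s m h _ => ?_⟩⟩
  · rw [← cancel_mono b, Category.assoc, ← hsq, reassoc_of% hl s, s.condition]
  · rw [← cancel_mono j, h, hl]

theorem isPushout_of_conflation {w₁ : i ≫ p = 0} {w₂ : d ≫ e = 0}
    (h₁ : E.conflation (.mk i p w₁)) (h₂ : E.conflation (.mk d e w₂))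
    (hi : d ≫ j = i) (hsq : j ≫ p = e ≫ b) : IsPushout j e p b := by
  have := E.epi_of_conflation h₁
  have := E.epi_of_conflation h₂
  have key : ∀ s : PushoutCocone j e, ∃ l : X ⟶ s.pt, p ≫ l = s.inl := fun s =>
    E.exists_desc h₁ s.inl (by
      rw [← hi, Category.assoc, s.condition, reassoc_of% w₂, zero_comp])
  choose l hl using key
  refine ⟨⟨hsq⟩, ⟨PushoutCocone.IsColimit.mk _ l hl (fun s => ?_) fun s m h _ => ?_⟩⟩
  · rw [← cancel_epi e, ← reassoc_of% hsq, hl s, s.condition]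
  · rw [← cancel_epi p, h, hl]

theorem exists_isPullback {w₂ : i ≫ p = 0} (h₂ : E.conflation (.mk i p w₂)) (b : B ⟶ X) :
    ∃ (P : C) (j : P ⟶ Y) (e : P ⟶ B), IsPullback j e p b := by
  obtain ⟨P, j, e, h, -⟩ := E.pullback_epi p b ⟨_, i, w₂, h₂⟩
  exact ⟨P, j, e, h⟩

theorem exists_isPushout {w₁ : j ≫ q = 0} (h₁ : E.conflation (.mk j q w₁)) (e : X' ⟶ B) :
    ∃ (P : C) (p : Y ⟶ P) (b : B ⟶ P), IsPushout j e p b := by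
  obtain ⟨P, p, b, h, -⟩ := E.pushout_mono j e ⟨_, q, w₁, h₁⟩
  exact ⟨P, p, b, h⟩

/-- The preimage of `B` in `Y` is the kernel of `Y ↠ X ↠ A` and still contains `D`, with quotient
`B`. Closure of admissible epimorphisms under composition and pullback makes both sequences
conflations. -/
theorem conflations_of_isPullback {w₁ : b ≫ a = 0} {w₂ : i ≫ p = 0}
    (h₁ : E.conflation (.mk b a w₁)) (h₂ : E.conflation (.mk i p w₂))
    (hP : IsPullback j e p b) :
    (∃ w, E.conflation (.mk j (p ≫ a) w)) ∧
      ∃ (d : D ⟶ X') (w : d ≫ e = 0), d ≫ j = i ∧ E.conflation (.mk d e w) := by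
  have := E.mono_of_conflation h₁
  have := E.mono_of_conflation h₂
  have hj : Mono j := ⟨fun u v h => hP.hom_ext h (by
    rw [← cancel_mono b, Category.assoc, Category.assoc, ← hP.w, reassoc_of% h])⟩
  constructor
  · obtain ⟨K, f, w, hf⟩ := E.comp_epi p a ⟨_, i, w₂, h₂⟩ ⟨_, b, w₁, h₁⟩
    obtain ⟨t, ht⟩ := E.exists_lift h₁ (f ≫ p) (by simpa using w)
    have w' : j ≫ p ≫ a = 0 := by rw [hP.w_assoc, w₁, comp_zero]
    exact ⟨w', E.conflation_of_mono hf j w' (hP.lift f t ht.symm) (by simp)⟩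
  -- The axiom provides some pullback with some kernel; the conflation is carried over to the given
  -- pullback, and its kernel is then exchanged for the lift of `(i, 0)`.
  · obtain ⟨P, j', e', hP', K, f, w, hf⟩ := E.pullback_epi p b ⟨_, i, w₂, h₂⟩
    have w₃ : i ≫ p = (0 : D ⟶ B) ≫ b := by simp [w₂]
    have hde : hP.lift i 0 w₃ ≫ e = 0 := by simp
    have hdj : hP.lift i 0 w₃ ≫ j = i := by simp
    have : Mono (hP.lift i 0 w₃) := by
      have : Mono (hP.lift i 0 w₃ ≫ j) := by rw [hdj]; infer_instance
      exact mono_of_mono _ j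
    refine ⟨hP.lift i 0 w₃, hde, hdj, ?_⟩
    let φ : P ≅ X' := hP'.isoIsPullback _ _ hP
    have hφ : φ.inv ≫ e' = e := by simp [φ]
    have hφ' : φ.hom ≫ e = e' := by simp [φ]
    have hw : (f ≫ φ.hom) ≫ e = 0 := by rw [Category.assoc, hφ', w]
    have hf' : E.conflation (.mk (f ≫ φ.hom) e hw) :=
      E.conflation_of_isos hf (Iso.refl _) φ (Iso.refl _) (by simp) (by simp [hφ'])
    obtain ⟨β, hβ⟩ := E.exists_lift h₂ ((f ≫ φ.hom) ≫ j) (by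
      rw [Category.assoc, hP.w, ← Category.assoc, hw, zero_comp])
    refine E.conflation_of_mono hf' _ hde β (hP.hom_ext ?_ ?_)
    · rw [Category.assoc, hdj, hβ]
    · rw [Category.assoc, hde, hw, comp_zero]

/-- Dual to the pullback case: the pushout of `Y` along `X' ↠ B` is the quotient of `Y` by `D`. -/
theorem conflations_of_isPushout {w₁ : j ≫ q = 0} {w₂ : d ≫ e = 0}
    (h₁ : E.conflation (.mk j q w₁)) (h₂ : E.conflation (.mk d e w₂))
    (hP : IsPushout j e p b) :
    (∃ w, E.conflation (.mk (d ≫ j) p w)) ∧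
      ∃ (a : X ⟶ A) (w : b ≫ a = 0), p ≫ a = q ∧ E.conflation (.mk b a w) := by
  have := E.epi_of_conflation h₁
  have := E.epi_of_conflation h₂
  have hp : Epi p := ⟨fun u v h => hP.hom_ext h (by
    rw [← cancel_epi e, ← hP.w_assoc, ← hP.w_assoc, h])⟩
  constructor
  · obtain ⟨K, f, w, hf⟩ := E.comp_mono d j ⟨_, e, w₂, h₂⟩ ⟨_, q, w₁, h₁⟩
    obtain ⟨t, ht⟩ := E.exists_desc h₂ (j ≫ f) (by simpa using w)
    have w' : (d ≫ j) ≫ p = 0 := by rw [Category.assoc, hP.w, reassoc_of% w₂, zero_comp]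
    exact ⟨w', E.conflation_of_epi hf p w' (hP.desc f t ht.symm) (by simp)⟩
  · obtain ⟨P, p', b', hP', K, f, w, hf⟩ := E.pushout_mono j e ⟨_, q, w₁, h₁⟩
    have w₃ : j ≫ q = e ≫ (0 : B ⟶ A) := by simp [w₁]
    have hba : b ≫ hP.desc q 0 w₃ = 0 := by simp
    have hpa : p ≫ hP.desc q 0 w₃ = q := by simp
    have : Epi (hP.desc q 0 w₃) := by
      have : Epi (p ≫ hP.desc q 0 w₃) := by rw [hpa]; infer_instance
      exact epi_of_epi p _
    refine ⟨hP.desc q 0 w₃, hba, hpa, ?_⟩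
    let φ : X ≅ P := hP.isoIsPushout _ _ hP'
    have hφ : b ≫ φ.hom = b' := by simp [φ]
    have hφ' : b' ≫ φ.inv = b := by simp [φ]
    have hw : b ≫ φ.hom ≫ f = 0 := by rw [reassoc_of% hφ, w]
    have hf' : E.conflation (.mk b (φ.hom ≫ f) hw) :=
      E.conflation_of_isos hf (Iso.refl _) φ.symm (Iso.refl _) (by simp [hφ']) (by simp)
    obtain ⟨β, hβ⟩ := E.exists_desc h₁ (p ≫ φ.hom ≫ f) (by
      rw [hP.w_assoc, hw, comp_zero])
    refine E.conflation_of_epi hf' _ hba β (hP.hom_ext ?_ ?_)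
    · rw [reassoc_of% hpa, hβ]
    · rw [reassoc_of% hba, hw, zero_comp]

end Conflations

/-! ### Counting flags -/

section Counting

variable {C : Type u} [Category.{v} C] [Preadditive C] (E : ExactStructure C)

/-- The two flags `(B ↣ X ↠ A, D ↣ Y ↠ X)` and `(X' ↣ Y ↠ A, D ↣ X' ↠ B)` fit into one
commutative diagram. -/
def FlagCompatible {A B D X X' Y : C} (l : E.SES A B X × E.SES X D Y)
    (r : E.SES A X' Y × E.SES B D X') : Prop :=
  r.2.1.1 ≫ r.1.1.1 = l.2.1.1 ∧ l.2.1.2 ≫ l.1.1.2 = r.1.1.2 ∧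
    r.1.1.1 ≫ l.2.1.2 = r.2.1.2 ≫ l.1.1.1

/-- A compatible right flag exhibits `X'` as a pullback of `p` and `b`, and is determined by the two
projections. Such flags therefore correspond to the isomorphisms from `X'` to one fixed pullback
`P`. -/
theorem exists_card_flagCompatible_right {A B D X Y : C} (l : E.SES A B X × E.SES X D Y) :
    ∃ P : C, Nonempty (E.SES B D P) ∧
      ∀ X', Nat.card {r : E.SES A X' Y × E.SES B D X' // E.FlagCompatible l r} =
        Nat.card (X' ≅ P) := by
  obtain ⟨⟨⟨b, a⟩, w₁, h₁⟩, ⟨⟨i, p⟩, w₂, h₂⟩⟩ := l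
  dsimp only at w₁ h₁ w₂ h₂
  obtain ⟨P, j, e, hP⟩ := E.exists_isPullback h₂ b
  have hPc := E.conflations_of_isPullback h₁ h₂ hP
  refine ⟨P, ?_, fun X' => ?_⟩
  · obtain ⟨-, d, w, -, h⟩ := hPc
    exact ⟨⟨(d, e), w, h⟩⟩
  have pb : ∀ r : {r : E.SES A X' Y × E.SES B D X' // E.FlagCompatible
      (⟨⟨(b, a), w₁, h₁⟩, ⟨(i, p), w₂, h₂⟩⟩ : E.SES A B X × E.SES X D Y) r},
      IsPullback r.1.1.1.1 r.1.2.1.2 p b := by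
    rintro ⟨⟨⟨⟨j', q⟩, w₃, h₃⟩, ⟨⟨d, e'⟩, w₄, h₄⟩⟩, -, hq, hsq⟩
    exact E.isPullback_of_conflation h₁ h₃ hq hsq
  refine Nat.card_congr (Equiv.ofBijective (fun r => (pb r).isoIsPullback _ _ hP) ⟨?_, ?_⟩)
  · intro r s hrs
    have hj : r.1.1.1.1 = s.1.1.1.1 := by
      rw [← (pb r).isoIsPullback_hom_fst _ _ hP, ← (pb s).isoIsPullback_hom_fst _ _ hP]
      exact congrArg (fun t : X' ≅ P => t.hom ≫ j) hrs
    have he : r.1.2.1.2 = s.1.2.1.2 := by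
      rw [← (pb r).isoIsPullback_hom_snd _ _ hP, ← (pb s).isoIsPullback_hom_snd _ _ hP]
      exact congrArg (fun t : X' ≅ P => t.hom ≫ e) hrs
    clear hrs
    revert hj he
    obtain ⟨⟨⟨⟨j₁, q₁⟩, w₃, h₃⟩, ⟨⟨d₁, e₁⟩, w₄, h₄⟩⟩, hd₁, hq₁, -⟩ := r
    obtain ⟨⟨⟨⟨j₂, q₂⟩, w₅, h₅⟩, ⟨⟨d₂, e₂⟩, w₆, h₆⟩⟩, hd₂, hq₂, -⟩ := s
    -- Of the remaining two maps, `q` is forced to be `p ≫ a`, and `d` is forced because `j` is a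
    -- monomorphism.
    intro hj he
    dsimp only at hj he hd₁ hd₂ hq₁ hq₂
    subst hj; subst he; subst hq₁; subst hq₂
    have := E.mono_of_conflation h₃
    obtain rfl : d₁ = d₂ := by rw [← cancel_mono j₁, hd₁, hd₂]
    rfl
  · intro φ
    have hP' : IsPullback (φ.hom ≫ j) (φ.hom ≫ e) p b :=
      IsPullback.of_iso hP φ.symm (Iso.refl _) (Iso.refl _) (Iso.refl _)
        (by simp) (by simp) (by simp) (by simp)
    obtain ⟨⟨w₃, h₃⟩, d, w₄, hd, h₄⟩ := E.conflations_of_isPullback h₁ h₂ hP'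
    refine ⟨⟨⟨⟨(_, _), w₃, h₃⟩, ⟨(_, _), w₄, h₄⟩⟩, hd, rfl, hP'.w⟩, ?_⟩
    ext
    apply hP.hom_ext <;> simp

theorem exists_card_flagCompatible_left {A B D X' Y : C} (r : E.SES A X' Y × E.SES B D X') :
    ∃ P : C, Nonempty (E.SES A B P) ∧
      ∀ X, Nat.card {l : E.SES A B X × E.SES X D Y // E.FlagCompatible l r} =
        Nat.card (X ≅ P) := by
  obtain ⟨⟨⟨j, q⟩, w₁, h₁⟩, ⟨⟨d, e⟩, w₂, h₂⟩⟩ := r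
  dsimp only at w₁ h₁ w₂ h₂
  obtain ⟨P, p, b, hP⟩ := E.exists_isPushout h₁ e
  have hPc := E.conflations_of_isPushout h₁ h₂ hP
  refine ⟨P, ?_, fun X => ?_⟩
  · obtain ⟨-, a, w, -, h⟩ := hPc
    exact ⟨⟨(b, a), w, h⟩⟩
  have po : ∀ l : {l : E.SES A B X × E.SES X D Y // E.FlagCompatible l
      (⟨⟨(j, q), w₁, h₁⟩, ⟨(d, e), w₂, h₂⟩⟩ : E.SES A X' Y × E.SES B D X')},
      IsPushout j e l.1.2.1.2 l.1.1.1.1 := by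
    rintro ⟨⟨⟨⟨b', a'⟩, w₃, h₃⟩, ⟨⟨i', p'⟩, w₄, h₄⟩⟩, hi, -, hsq⟩
    exact E.isPushout_of_conflation h₄ h₂ hi hsq
  refine Nat.card_congr (Equiv.ofBijective (fun l => (po l).isoIsPushout _ _ hP) ⟨?_, ?_⟩)
  · intro r s hrs
    have hp : r.1.2.1.2 = s.1.2.1.2 := by
      rw [← (po r).inl_isoIsPushout_inv _ _ hP, ← (po s).inl_isoIsPushout_inv _ _ hP]
      exact congrArg (fun t : X ≅ P => p ≫ t.inv) hrs
    have hb : r.1.1.1.1 = s.1.1.1.1 := by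
      rw [← (po r).inr_isoIsPushout_inv _ _ hP, ← (po s).inr_isoIsPushout_inv _ _ hP]
      exact congrArg (fun t : X ≅ P => b ≫ t.inv) hrs
    clear hrs
    revert hp hb
    obtain ⟨⟨⟨⟨b₁, a₁⟩, w₃, h₃⟩, ⟨⟨i₁, p₁⟩, w₄, h₄⟩⟩, hi₁, hq₁, -⟩ := r
    obtain ⟨⟨⟨⟨b₂, a₂⟩, w₅, h₅⟩, ⟨⟨i₂, p₂⟩, w₆, h₆⟩⟩, hi₂, hq₂, -⟩ := s
    intro hp hb
    dsimp only at hp hb hi₁ hi₂ hq₁ hq₂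
    subst hp; subst hb; subst hi₁; subst hi₂
    have := E.epi_of_conflation h₄
    obtain rfl : a₁ = a₂ := by rw [← cancel_epi p₁, hq₁, hq₂]
    rfl
  · intro φ
    have hP' : IsPushout j e (p ≫ φ.inv) (b ≫ φ.inv) :=
      IsPushout.of_iso hP (Iso.refl _) (Iso.refl _) (Iso.refl _) φ.symm
        (by simp) (by simp) (by simp) (by simp)
    obtain ⟨⟨w₃, h₃⟩, a, w₄, ha, h₄⟩ := E.conflations_of_isPushout h₁ h₂ hP'
    refine ⟨⟨⟨⟨(_, _), w₄, h₄⟩, ⟨(_, _), w₃, h₃⟩⟩, rfl, ha, hP'.w⟩, ?_⟩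
    apply Iso.symm_eq_iff.1
    ext
    apply hP.hom_ext <;> simp

/-- The action is free: the first map of a conflation is mono and the second is epi, so a
stabilizing pair of automorphisms is trivial. -/
theorem card_ses [∀ X Y : C, Finite (X ⟶ Y)] (A B X : C) :
    Nat.card (E.SES A B X) = E.orbitCount A B X * (Nat.card (Aut A) * Nat.card (Aut B)) := by
  rw [orbitCount, ← Nat.card_prod (Aut A) (Aut B), ← Nat.card_prod]
  refine Nat.card_congr (MulAction.selfEquivOrbitsQuotientProd fun p => ?_)
  rw [eq_bot_iff]
  rintro ⟨s, t⟩ hst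
  obtain ⟨⟨i, q⟩, w, h⟩ := p
  have := E.mono_of_conflation h
  have := E.epi_of_conflation h
  have hst' : SES.map E s t (Iso.refl X) _ = _ := hst
  have h₁ := congrArg (fun z : E.SES A B X => z.1.1) hst'
  have h₂ := congrArg (fun z : E.SES A B X => z.1.2) hst'
  simp only [SES.map, Iso.refl_hom, Iso.refl_inv, Category.comp_id, Category.id_comp] at h₁ h₂
  rw [Subgroup.mem_bot, Prod.mk_eq_one]
  constructor
  · ext
    rw [← cancel_epi q]
    exact h₂.trans (Category.comp_id q).symm
  · rw [← inv_eq_one]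
    ext
    rw [← cancel_mono i]
    exact h₁.trans (Category.id_comp i).symm

end Counting

end ExactStructure

/-! ### Automorphism counts and associativity of Hall numbers -/

theorem IsoClass.mk_out {C : Type u} [Category.{v} C] (x : IsoClass C) :
    IsoClass.mk (Quotient.out x) = x := Quotient.out_eq x

theorem IsoClass.autCard_mk {C : Type u} [Category.{v} C] (X : C) :
    (IsoClass.mk X).autCard = Nat.card (Aut X) := rfl

theorem CategoryTheory.finite_iso {C : Type u} [Category.{v} C] (X Y : C) [Finite (X ⟶ Y)] :
    Finite (X ≅ Y) :=
  Finite.of_injective (fun e : X ≅ Y => e.hom) fun _ _ h => Iso.ext h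

theorem IsoClass.autCard_pos {C : Type u} [Category.{v} C] (hfin : ∀ X Y : C, Finite (X ⟶ Y))
    (x : IsoClass C) : 0 < x.autCard := by
  obtain ⟨X, rfl⟩ := IsoClass.exists_mk x
  have : Finite (Aut X) := finite_iso X X
  exact Nat.card_pos

open Classical in
theorem IsoClass.card_iso {C : Type u} [Category.{v} C] (X P : C) :
    Nat.card (X ≅ P) =
      if IsoClass.mk X = IsoClass.mk P then (IsoClass.mk X).autCard else 0 := by
  split_ifs with h
  · obtain ⟨e⟩ := IsoClass.mk_eq_mk_iff.1 h
    exact Nat.card_congr ⟨fun f => f ≪≫ e.symm, fun f => f ≪≫ e, fun f => by ext; simp,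
      fun f => by
        apply Iso.ext
        change (f.hom ≫ e.hom) ≫ e.inv = f.hom
        simp⟩
  · have : IsEmpty (X ≅ P) := ⟨fun f => h (IsoClass.mk_eq_mk_iff.2 ⟨f⟩)⟩
    exact Nat.card_of_isEmpty

namespace ExactStructure

variable {C : Type u} [Category.{v} C] [Preadditive C]

theorem hallNumber_mk_ne_zero (E : ExactStructure C) (hfin : ∀ X Y : C, Finite (X ⟶ Y)) {A B X : C}
    (h : Nonempty (E.SES A B X)) : E.hallNumber (.mk A) (.mk B) (.mk X) ≠ 0 := by
  have : Finite (E.SES A B X) := Subtype.finite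
  intro h0
  have := E.card_ses A B X
  rw [show E.orbitCount A B X = 0 from h0, zero_mul] at this
  exact Nat.card_pos.ne' this

theorem hallNumber_ne_zero_iff (E : ExactStructure C) (hfin : ∀ X Y : C, Finite (X ⟶ Y))
    {a b x : IsoClass C} : E.hallNumber a b x ≠ 0 ↔ x ∈ E.extClasses a b := by
  refine ⟨E.mem_extClasses_of_hallNumber_ne_zero, ?_⟩
  rintro ⟨S, hS, rfl, rfl, rfl⟩
  exact E.hallNumber_mk_ne_zero hfin ⟨⟨(S.f, S.g), S.zero, hS⟩⟩

/-- Weighted double counting of a relation between two families of finite types. -/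
theorem sum_card_div_eq_of_relation {ι κ : Type*} (S : Finset ι) (T : Finset κ)
    {L : ι → Type*} {R : κ → Type*} [∀ x, Finite (L x)] [∀ x, Finite (R x)]
    (W : ∀ x y, L x → R y → Prop) (c : ι → ℚ) (c' : κ → ℚ)
    (h₁ : ∀ x ∈ S, ∀ l : L x, ∑ y ∈ T, (Nat.card {r : R y // W x y l r} : ℚ) / c' y = 1)
    (h₂ : ∀ y ∈ T, ∀ r : R y, ∑ x ∈ S, (Nat.card {l : L x // W x y l r} : ℚ) / c x = 1) :
    ∑ x ∈ S, (Nat.card (L x) : ℚ) / c x = ∑ y ∈ T, (Nat.card (R y) : ℚ) / c' y := by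
  classical
  have := fun x => Fintype.ofFinite (L x)
  have := fun x => Fintype.ofFinite (R x)
  calc ∑ x ∈ S, (Nat.card (L x) : ℚ) / c x
      = ∑ x ∈ S, ∑ y ∈ T, (∑ l : L x, (Nat.card {r : R y // W x y l r} : ℚ)) / (c' y * c x) := by
        refine Finset.sum_congr rfl fun x hx => ?_
        rw [Nat.card_eq_fintype_card, ← Finset.card_univ, Finset.card_eq_sum_ones, Nat.cast_sum,
          Finset.sum_div]
        simp_rw [Finset.sum_div]
        rw [Finset.sum_comm]
        refine Finset.sum_congr rfl fun l _ => ?_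
        -- Each element of `L x`, counted as `1`, is spread over its partners in the `R y`; both
        -- sides then become the same weighted count of related pairs.
        rw [Nat.cast_one, ← h₁ x hx l, Finset.sum_div]
        simp_rw [div_div]
    _ = ∑ y ∈ T, ∑ x ∈ S, (∑ r : R y, (Nat.card {l : L x // W x y l r} : ℚ)) / (c x * c' y) := by
        rw [Finset.sum_comm]
        refine Finset.sum_congr rfl fun y _ => Finset.sum_congr rfl fun x _ => ?_
        rw [mul_comm]
        congr 1
        simp_rw [Nat.card_eq_fintype_card, Fintype.card_subtype, Finset.card_filter, Nat.cast_sum]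
        rw [Finset.sum_comm]
    _ = _ := by
        refine Finset.sum_congr rfl fun y hy => ?_
        rw [Nat.card_eq_fintype_card, ← Finset.card_univ, Finset.card_eq_sum_ones, Nat.cast_sum,
          Finset.sum_div]
        simp_rw [Finset.sum_div]
        rw [Finset.sum_comm]
        refine Finset.sum_congr rfl fun l _ => ?_
        rw [Nat.cast_one, ← h₂ y hy l, Finset.sum_div]
        simp_rw [div_div]

theorem hallNumber_eq_div (E : ExactStructure C) (hfin : ∀ X Y : C, Finite (X ⟶ Y)) (A B X : C) :
    (E.hallNumber (.mk A) (.mk B) (.mk X) : ℚ) =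
      Nat.card (E.SES A B X) / ((IsoClass.mk A).autCard * (IsoClass.mk B).autCard) := by
  have hA : ((IsoClass.mk A).autCard : ℚ) ≠ 0 := by exact_mod_cast (IsoClass.autCard_pos hfin _).ne'
  have hB : ((IsoClass.mk B).autCard : ℚ) ≠ 0 := by exact_mod_cast (IsoClass.autCard_pos hfin _).ne'
  rw [E.card_ses, hallNumber_mk, IsoClass.autCard_mk, IsoClass.autCard_mk]
  rw [IsoClass.autCard_mk] at hA hB
  push_cast
  field_simp

/-- These are the coefficients of `y` in the two bracketings of a triple product. Both count flags
in `Y` with successive quotients `A`, `B`, `D`; with the weight `1 / #Aut` of the intermediate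
object, each flag on one side has partners of total weight `1` on the other. -/
theorem sum_hallNumber_mul (E : ExactStructure C) (hfin : ∀ X Y : C, Finite (X ⟶ Y))
    (a b d y : IsoClass C) (S T : Finset (IsoClass C))
    (hS : ∀ x, x ∈ S ↔ E.hallNumber a b x ≠ 0) (hT : ∀ x, x ∈ T ↔ E.hallNumber b d x ≠ 0) :
    ∑ x ∈ S, (E.hallNumber a b x * E.hallNumber x d y : ℚ) =
      ∑ x ∈ T, (E.hallNumber b d x * E.hallNumber a x y : ℚ) := by
  classical
  obtain ⟨A, rfl⟩ := IsoClass.exists_mk a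
  obtain ⟨B, rfl⟩ := IsoClass.exists_mk b
  obtain ⟨D, rfl⟩ := IsoClass.exists_mk d
  obtain ⟨Y, rfl⟩ := IsoClass.exists_mk y
  have hSES : ∀ A B X, Finite (E.SES A B X) := fun A B X => Subtype.finite
  have pos : ∀ x : IsoClass C, (x.autCard : ℚ) ≠ 0 := fun x => by
    exact_mod_cast (IsoClass.autCard_pos hfin x).ne'
  have hsum : ∀ (P : C) (U : Finset (IsoClass C)), IsoClass.mk P ∈ U →
      ∑ x ∈ U, (Nat.card ((Quotient.out x : C) ≅ P) : ℚ) / (x.autCard : ℚ) = 1 := by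
    intro P U hU
    rw [Finset.sum_eq_single_of_mem _ hU]
    · rw [IsoClass.card_iso, IsoClass.mk_out, if_pos rfl, div_self (pos _)]
    · intro x _ hx
      rw [IsoClass.card_iso, IsoClass.mk_out, if_neg hx, Nat.cast_zero, zero_div]
  have hL : ∀ x : IsoClass C, Finite (E.SES A B (Quotient.out x : C) × E.SES (Quotient.out x) D Y) :=
    fun x => inferInstance
  have hR : ∀ x : IsoClass C, Finite (E.SES A (Quotient.out x : C) Y × E.SES B D (Quotient.out x)) :=
    fun x => inferInstance
  have key := sum_card_div_eq_of_relation S T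
    (L := fun x => E.SES A B (Quotient.out x) × E.SES (Quotient.out x) D Y)
    (R := fun x => E.SES A (Quotient.out x) Y × E.SES B D (Quotient.out x))
    (fun x y l r => E.FlagCompatible l r) (fun x => x.autCard) (fun x => x.autCard)
    (fun x _ l => by
      obtain ⟨P, hP, h⟩ := E.exists_card_flagCompatible_right l
      simp_rw [h]
      exact hsum P T ((hT _).2 (E.hallNumber_mk_ne_zero hfin hP)))
    (fun y _ r => by
      obtain ⟨P, hP, h⟩ := E.exists_card_flagCompatible_left r
      simp_rw [h]
      exact hsum P S ((hS _).2 (E.hallNumber_mk_ne_zero hfin hP)))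
  -- The intermediate object is an end term of only one of the two sequences, so its automorphisms
  -- are divided out once. This gives the weight; the other three factors are common to both sides.
  have e₁ : ∀ x : IsoClass C, (E.hallNumber (.mk A) (.mk B) x * E.hallNumber x (.mk D) (.mk Y) : ℚ)
      = (Nat.card (E.SES A B (Quotient.out x) × E.SES (Quotient.out x) D Y) : ℚ) / x.autCard /
        ((IsoClass.mk A).autCard * (IsoClass.mk B).autCard * (IsoClass.mk D).autCard) := by
    intro x
    have h₁ := E.hallNumber_eq_div hfin A B (Quotient.out x)
    have h₂ := E.hallNumber_eq_div hfin (Quotient.out x) D Y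
    rw [IsoClass.mk_out] at h₁ h₂
    rw [h₁, h₂, Nat.card_prod]
    have := pos x; have := pos (.mk A); have := pos (.mk B); have := pos (.mk D)
    push_cast
    field_simp
  have e₂ : ∀ x : IsoClass C, (E.hallNumber (.mk B) (.mk D) x * E.hallNumber (.mk A) x (.mk Y) : ℚ)
      = (Nat.card (E.SES A (Quotient.out x) Y × E.SES B D (Quotient.out x)) : ℚ) / x.autCard /
        ((IsoClass.mk A).autCard * (IsoClass.mk B).autCard * (IsoClass.mk D).autCard) := by
    intro x
    have h₁ := E.hallNumber_eq_div hfin B D (Quotient.out x)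
    have h₂ := E.hallNumber_eq_div hfin A (Quotient.out x) Y
    rw [IsoClass.mk_out] at h₁ h₂
    rw [h₁, h₂, Nat.card_prod]
    have := pos x; have := pos (.mk A); have := pos (.mk B); have := pos (.mk D)
    push_cast
    field_simp
  simp_rw [e₁, e₂, ← Finset.sum_div]
  rw [key]

end ExactStructure

/-! ### Extensions involving zero, split extensions, Grothendieck classes -/

theorem IsoClass.mk_eq_zero_iff {C : Type u} [Category.{v} C] [Preadditive C] [HasZeroObject C]
    [HasBinaryBiproducts C] {X : C} : IsoClass.mk X = 0 ↔ IsZero X := by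
  rw [IsoClass.zero_def, IsoClass.mk_eq_mk_iff]
  exact ⟨fun ⟨e⟩ => (isZero_zero C).of_iso e, fun h => ⟨h.iso (isZero_zero C)⟩⟩

theorem IsoClass.autCard_zero {C : Type u} [Category.{v} C] [Preadditive C] [HasZeroObject C]
    [HasBinaryBiproducts C] : (0 : IsoClass C).autCard = 1 := by
  rw [IsoClass.zero_def, IsoClass.autCard_mk, Nat.card_eq_one_iff_unique]
  exact ⟨⟨fun f g => Iso.ext ((isZero_zero C).eq_of_src _ _)⟩, ⟨1⟩⟩

namespace ExactStructure

variable {C : Type u} [Category.{v} C] [Preadditive C] [HasZeroObject C] [HasBinaryBiproducts C]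

section Extensions

variable (E : ExactStructure C)

/-- The identity axiom leaves the third term open, but the cokernel map of an identity is both zero
and epi, so that term is a zero object. -/
theorem conflation_iso_left {X Y Z : C} (φ : X ≅ Y) (hZ : IsZero Z) :
    E.conflation (.mk φ.hom (0 : Y ⟶ Z) comp_zero) := by
  obtain ⟨W, g, w, h⟩ := E.id_mono X
  have := E.epi_of_conflation h
  have hg : g = 0 := by simpa using w
  have hW : IsZero W := by
    rw [IsZero.iff_id_eq_zero, ← cancel_epi g]
    simp [hg]
  exact E.conflation_of_isos h (Iso.refl _) φ (hW.iso hZ) (by simp) (by simp [hg])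

theorem conflation_iso_right {X Y Z : C} (φ : X ≅ Y) (hZ : IsZero Z) :
    E.conflation (.mk (0 : Z ⟶ X) φ.hom zero_comp) := by
  obtain ⟨W, f, w, h⟩ := E.id_epi Y
  have := E.mono_of_conflation h
  have hf : f = 0 := by simpa using w
  have hW : IsZero W := by
    rw [IsZero.iff_id_eq_zero, ← cancel_mono f]
    simp [hf]
  exact E.conflation_of_isos h (hW.iso hZ) φ.symm (Iso.refl _) (by simp [hf]) (by simp)

theorem mem_extClasses_iff {A B X : C} :
    IsoClass.mk X ∈ E.extClasses (.mk A) (.mk B) ↔ Nonempty (E.SES A B X) := by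
  constructor
  · rintro ⟨@⟨X₁, X₂, X₃, f, g, w⟩, h, h₁, h₂, h₃⟩
    obtain ⟨e₁⟩ := IsoClass.mk_eq_mk_iff.1 h₁
    obtain ⟨e₂⟩ := IsoClass.mk_eq_mk_iff.1 h₂
    obtain ⟨e₃⟩ := IsoClass.mk_eq_mk_iff.1 h₃
    exact ⟨SES.map E e₃ e₁ e₂ ⟨(f, g), w, h⟩⟩
  · rintro ⟨⟨⟨i, q⟩, w, h⟩⟩
    exact ⟨_, h, rfl, rfl, rfl⟩

theorem isIso_of_conflation_left {A B X : C} {i : B ⟶ X} {q : X ⟶ A} {w : i ≫ q = 0}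
    (h : E.conflation (.mk i q w)) (hA : IsZero A) : IsIso i := by
  have := E.mono_of_conflation h
  obtain ⟨s, hs⟩ := E.exists_lift h (𝟙 X) (hA.eq_of_tgt _ _)
  exact ⟨s, by rw [← cancel_mono i, Category.assoc, hs]; simp, hs⟩

theorem isIso_of_conflation_right {A B X : C} {i : B ⟶ X} {q : X ⟶ A} {w : i ≫ q = 0}
    (h : E.conflation (.mk i q w)) (hB : IsZero B) : IsIso q := by
  have := E.epi_of_conflation h
  obtain ⟨s, hs⟩ := E.exists_desc h (𝟙 X) (hB.eq_of_src _ _)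
  exact ⟨s, hs, by rw [← cancel_epi q, reassoc_of% hs]; simp⟩

theorem eq_of_mem_extClasses_zero_left {b x : IsoClass C} (h : x ∈ E.extClasses 0 b) : x = b := by
  obtain ⟨@⟨X₁, X₂, X₃, f, g, w⟩, h, rfl, rfl, h₃⟩ := h
  have := E.isIso_of_conflation_left h (IsoClass.mk_eq_zero_iff.1 h₃)
  exact IsoClass.mk_eq_mk_iff.2 ⟨(asIso f).symm⟩

theorem eq_of_mem_extClasses_zero_right {a x : IsoClass C} (h : x ∈ E.extClasses a 0) :
    x = a := by
  obtain ⟨@⟨X₁, X₂, X₃, f, g, w⟩, h, h₁, rfl, rfl⟩ := h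
  have := E.isIso_of_conflation_right h (IsoClass.mk_eq_zero_iff.1 h₁)
  exact IsoClass.mk_eq_mk_iff.2 ⟨asIso g⟩

theorem eq_zero_of_zero_mem_extClasses {a b : IsoClass C} (h : 0 ∈ E.extClasses a b) :
    a = 0 ∧ b = 0 := by
  obtain ⟨@⟨X₁, X₂, X₃, f, g, w⟩, h, rfl, h₂, rfl⟩ := h
  have := E.mono_of_conflation h
  have := E.epi_of_conflation h
  have h₂ := IsoClass.mk_eq_zero_iff.1 h₂
  exact ⟨IsoClass.mk_eq_zero_iff.2 (IsZero.of_epi g h₂),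
    IsoClass.mk_eq_zero_iff.2 (IsZero.of_mono f h₂)⟩

theorem add_mem_extClasses (a b : IsoClass C) : a + b ∈ E.extClasses a b := by
  obtain ⟨B, rfl⟩ := IsoClass.exists_mk b
  have h : IsoClass.mk B ∈ E.extClasses 0 (.mk B) :=
    E.mem_extClasses_iff.2 ⟨⟨(𝟙 B, 0), _, E.conflation_iso_left (Iso.refl B) (isZero_zero C)⟩⟩
  simpa [add_comm] using E.extClasses_add h a

theorem grothendieckClass_of_mem_extClasses {a b x : IsoClass C} (h : x ∈ E.extClasses a b) :
    E.grothendieckClass x = E.grothendieckClass a + E.grothendieckClass b := by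
  rw [← map_add]
  exact (AddCon.eq _).2 (.rel _ _ ⟨a, b, h, E.add_mem_extClasses a b⟩)

/-- The zero class is isolated for `extRel`: if `0` is a middle term then both end terms vanish, and
then `0` is the only middle term. -/
theorem grothendieckClass_eq_zero_iff {x : IsoClass C} : E.grothendieckClass x = 0 ↔ x = 0 := by
  refine ⟨fun h => ?_, fun h => by rw [h, map_zero]⟩
  have key : ∀ y z : IsoClass C, E.extRel y z → y = 0 → z = 0 := by
    rintro y z ⟨a, b, hy, hz⟩ rfl
    obtain ⟨rfl, rfl⟩ := E.eq_zero_of_zero_mem_extClasses hy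
    exact E.eq_of_mem_extClasses_zero_left hz
  rw [← map_zero E.grothendieckClass] at h
  have h' : Relation.EqvGen E.extRel x 0 := (AddCon.eq _).1 h
  have : ∀ y z : IsoClass C, Relation.EqvGen E.extRel y z → (y = 0 ↔ z = 0) := by
    intro y z hyz
    induction hyz with
    | rel _ _ h => exact ⟨key _ _ h, key _ _ (E.extRel_symm h)⟩
    | refl _ => rfl
    | symm _ _ _ ih => exact ih.symm
    | trans _ _ _ _ _ ih₁ ih₂ => exact ih₁.trans ih₂
  exact (this x 0 h').2 rfl

open Classical in
-- The conflations `X ↣ X ↠ 0` are exactly the automorphisms of `X`, hence form a single free orbit.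
theorem hallNumber_zero_left (hfin : ∀ X Y : C, Finite (X ⟶ Y)) (b x : IsoClass C) :
    E.hallNumber 0 b x = if x = b then 1 else 0 := by
  split_ifs with h
  · subst h
    obtain ⟨X, rfl⟩ := IsoClass.exists_mk x
    have hp := IsoClass.autCard_pos hfin (.mk X)
    have e : Nat.card (E.SES (0 : C) X X) = Nat.card (Aut X) := by
      refine (Nat.card_congr (Equiv.ofBijective (fun φ : Aut X =>
        (⟨(Iso.hom φ, 0), _, E.conflation_iso_left φ (isZero_zero C)⟩ : E.SES (0 : C) X X))
          ⟨fun φ ψ h => ?_, ?_⟩)).symm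
      · exact Iso.ext (congrArg (fun p : E.SES (0 : C) X X => p.1.1) h)
      · rintro ⟨⟨i, q⟩, w, h⟩
        have := E.isIso_of_conflation_left h (isZero_zero C)
        exact ⟨asIso i, Subtype.ext (Prod.ext rfl ((isZero_zero C).eq_of_tgt _ _))⟩
    have h₁ := E.card_ses (0 : C) X X
    rw [← IsoClass.autCard_mk (0 : C), ← IsoClass.zero_def, IsoClass.autCard_zero, e, one_mul,
      ← IsoClass.autCard_mk] at h₁
    rw [IsoClass.zero_def, hallNumber_mk]
    exact (Nat.eq_of_mul_eq_mul_right hp (by rw [one_mul]; exact h₁)).symm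
  · by_contra h0
    exact h (E.eq_of_mem_extClasses_zero_left ((E.hallNumber_ne_zero_iff hfin).1 h0))

open Classical in
theorem hallNumber_zero_right (hfin : ∀ X Y : C, Finite (X ⟶ Y)) (a x : IsoClass C) :
    E.hallNumber a 0 x = if x = a then 1 else 0 := by
  split_ifs with h
  · subst h
    obtain ⟨X, rfl⟩ := IsoClass.exists_mk x
    have hp := IsoClass.autCard_pos hfin (.mk X)
    have e : Nat.card (E.SES X (0 : C) X) = Nat.card (Aut X) := by
      refine (Nat.card_congr (Equiv.ofBijective (fun φ : Aut X =>
        (⟨(0, Iso.hom φ), _, E.conflation_iso_right φ (isZero_zero C)⟩ : E.SES X (0 : C) X))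
          ⟨fun φ ψ h => ?_, ?_⟩)).symm
      · exact Iso.ext (congrArg (fun p : E.SES X (0 : C) X => p.1.2) h)
      · rintro ⟨⟨i, q⟩, w, h⟩
        have := E.isIso_of_conflation_right h (isZero_zero C)
        exact ⟨asIso q, Subtype.ext (Prod.ext ((isZero_zero C).eq_of_src _ _) rfl)⟩
    have h₁ := E.card_ses X (0 : C) X
    rw [← IsoClass.autCard_mk (0 : C), ← IsoClass.zero_def, IsoClass.autCard_zero, e, mul_one,
      ← IsoClass.autCard_mk] at h₁
    rw [IsoClass.zero_def, hallNumber_mk]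
    exact (Nat.eq_of_mul_eq_mul_right hp (by rw [one_mul]; exact h₁)).symm
  · by_contra h0
    exact h (E.eq_of_mem_extClasses_zero_right ((E.hallNumber_ne_zero_iff hfin).1 h0))

end Extensions

/-! ### Endomorphism counts as a measure of size -/

section EndCard

/-- The number of endomorphisms of an object in a given isomorphism class. -/
noncomputable def _root_.IsoClass.endCard (x : IsoClass C) : ℕ :=
  Nat.card ((Quotient.out x : C) ⟶ Quotient.out x)

theorem _root_.IsoClass.endCard_mk (X : C) : (IsoClass.mk X).endCard = Nat.card (X ⟶ X) := by
  obtain ⟨e⟩ := IsoClass.mk_eq_mk_iff.1 (IsoClass.mk_out (IsoClass.mk X))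
  exact Nat.card_congr (e.homCongr e)

theorem card_biprod_end (A B : C) : Nat.card (A ⊞ B ⟶ A ⊞ B) =
    (Nat.card (A ⟶ A) * Nat.card (B ⟶ A)) * (Nat.card (A ⟶ B) * Nat.card (B ⟶ B)) := by
  have h₁ : ∀ Z : C, Nat.card (A ⊞ B ⟶ Z) = Nat.card (A ⟶ Z) * Nat.card (B ⟶ Z) := fun Z => by
    rw [← Nat.card_prod]
    exact Nat.card_congr ⟨fun f => (biprod.inl ≫ f, biprod.inr ≫ f), fun f => biprod.desc f.1 f.2,
      fun f => by ext <;> simp, fun f => by simp⟩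
  have h₂ : Nat.card (A ⊞ B ⟶ A ⊞ B) = Nat.card (A ⊞ B ⟶ A) * Nat.card (A ⊞ B ⟶ B) := by
    rw [← Nat.card_prod]
    exact Nat.card_congr ⟨fun f => (f ≫ biprod.fst, f ≫ biprod.snd), fun f => biprod.lift f.1 f.2,
      fun f => by ext <;> simp, fun f => by simp⟩
  rw [h₂, h₁, h₁]

/-- Write endomorphisms of `M ⊞ N` as matrices: `End M` is one factor of the count, and `End N`
contributes at least the two elements `0` and `𝟙 N`. -/
theorem _root_.IsoClass.endCard_lt_add (hfin : ∀ X Y : C, Finite (X ⟶ Y)) (m : IsoClass C)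
    {n : IsoClass C} (hn : n ≠ 0) : m.endCard < (m + n).endCard := by
  obtain ⟨M, rfl⟩ := IsoClass.exists_mk m
  obtain ⟨N, rfl⟩ := IsoClass.exists_mk n
  rw [IsoClass.mk_add_mk, IsoClass.endCard_mk, IsoClass.endCard_mk, card_biprod_end]
  have hM : 0 < Nat.card (M ⟶ M) := Nat.card_pos
  have h₁ : 0 < Nat.card (N ⟶ M) := Nat.card_pos
  have h₂ : 0 < Nat.card (M ⟶ N) := Nat.card_pos
  have hN : 1 < Nat.card (N ⟶ N) := by
    rw [Finite.one_lt_card_iff_nontrivial]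
    exact ⟨⟨𝟙 N, 0, fun h => hn (IsoClass.mk_eq_zero_iff.2 ((IsZero.iff_id_eq_zero N).2 h))⟩⟩
  calc Nat.card (M ⟶ M) = Nat.card (M ⟶ M) * 1 * (1 * 1) := by ring
    _ ≤ Nat.card (M ⟶ M) * Nat.card (N ⟶ M) * (Nat.card (M ⟶ N) * 1) := by gcongr <;> assumption
    _ < _ := by gcongr

variable (E : ExactStructure C)

/-- Left exactness of `Hom(-, Z)`. The image of restriction along `i` is kept, rather than bounded,
because its being proper detects nonsplitness. -/
theorem card_hom_from_eq {A B X : C} {i : B ⟶ X} {q : X ⟶ A} {w : i ≫ q = 0}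
    (h : E.conflation (.mk i q w)) (Z : C) :
    Nat.card (X ⟶ Z) = Nat.card (A ⟶ Z) * Nat.card (Preadditive.leftComp Z i).range := by
  have := E.epi_of_conflation h
  have e : Nat.card (Preadditive.leftComp Z i).ker = Nat.card (A ⟶ Z) := by
    refine (Nat.card_congr (Equiv.ofBijective (fun f : A ⟶ Z =>
      (⟨q ≫ f, by
        rw [AddMonoidHom.mem_ker]
        change i ≫ q ≫ f = 0
        rw [reassoc_of% w, zero_comp]⟩ : (Preadditive.leftComp Z i).ker)) ⟨?_, ?_⟩)).symm
    · intro f g hfg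
      rw [← cancel_epi q]
      exact congrArg Subtype.val hfg
    · rintro ⟨f, hf⟩
      obtain ⟨s, hs⟩ := E.exists_desc h f hf
      exact ⟨s, Subtype.ext hs⟩
  rw [AddSubgroup.card_eq_card_quotient_mul_card_addSubgroup (Preadditive.leftComp Z i).ker, e,
    mul_comm, Nat.card_congr (QuotientAddGroup.quotientKerEquivRange _).toEquiv]

theorem card_hom_from_le (hfin : ∀ X Y : C, Finite (X ⟶ Y)) {A B X : C} {i : B ⟶ X} {q : X ⟶ A}
    {w : i ≫ q = 0} (h : E.conflation (.mk i q w)) (Z : C) :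
    Nat.card (X ⟶ Z) ≤ Nat.card (A ⟶ Z) * Nat.card (B ⟶ Z) := by
  rw [E.card_hom_from_eq h Z]
  exact Nat.mul_le_mul_left _ (Nat.card_le_card_of_injective _ Subtype.val_injective)

theorem card_hom_to_le (hfin : ∀ X Y : C, Finite (X ⟶ Y)) {A B X : C} {i : B ⟶ X} {q : X ⟶ A}
    {w : i ≫ q = 0} (h : E.conflation (.mk i q w)) (Z : C) :
    Nat.card (Z ⟶ X) ≤ Nat.card (Z ⟶ A) * Nat.card (Z ⟶ B) := by
  have := E.mono_of_conflation h
  have e : Nat.card (Preadditive.rightComp Z q).ker = Nat.card (Z ⟶ B) := by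
    refine (Nat.card_congr (Equiv.ofBijective (fun f : Z ⟶ B =>
      (⟨f ≫ i, by
        rw [AddMonoidHom.mem_ker]
        change (f ≫ i) ≫ q = 0
        rw [Category.assoc, w, comp_zero]⟩ : (Preadditive.rightComp Z q).ker)) ⟨?_, ?_⟩)).symm
    · intro f g hfg
      rw [← cancel_mono i]
      exact congrArg Subtype.val hfg
    · rintro ⟨f, hf⟩
      obtain ⟨s, hs⟩ := E.exists_lift h f hf
      exact ⟨s, Subtype.ext hs⟩
  rw [AddSubgroup.card_eq_card_quotient_mul_card_addSubgroup (Preadditive.rightComp Z q).ker, e,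
    Nat.card_congr (QuotientAddGroup.quotientKerEquivRange _).toEquiv]
  exact Nat.mul_le_mul_right _ (Nat.card_le_card_of_injective _ Subtype.val_injective)

theorem nonempty_iso_biprod_of_retraction {A B X : C} {i : B ⟶ X} {q : X ⟶ A} {w : i ≫ q = 0}
    (h : E.conflation (.mk i q w)) (r : X ⟶ B) (hr : i ≫ r = 𝟙 B) : Nonempty (X ≅ A ⊞ B) := by
  have := E.epi_of_conflation h
  -- The idempotent complementary to `r ≫ i` vanishes on `B`, so it factors through `q`; the factor
  -- `s` is the section.
  obtain ⟨s, hs⟩ := E.exists_desc h (𝟙 X - r ≫ i) (by simp [reassoc_of% hr])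
  have hsq : s ≫ q = 𝟙 A := by
    rw [← cancel_epi q, reassoc_of% hs]
    simp [w]
  have hsr : s ≫ r = 0 := by
    rw [← cancel_epi q, reassoc_of% hs]
    simp [hr]
  exact ⟨⟨biprod.lift q r, biprod.desc s i, by simp [biprod.lift_desc, hs],
    by ext <;> simp [hsq, hsr, w, hr]⟩⟩

/-- Left exactness bounds `#End X` by the four factors of `#End (A ⊞ B)`. If the sequence does not
split, `𝟙 B` is not in the image of `Hom(X, B) → End B`, so the bound for `Hom(X, B)` is strict. -/
theorem eq_add_or_endCard_lt (hfin : ∀ X Y : C, Finite (X ⟶ Y)) {a b x : IsoClass C}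
    (hx : x ∈ E.extClasses a b) : x = a + b ∨ x.endCard < (a + b).endCard := by
  obtain ⟨@⟨B, X, A, i, q, w⟩, h, rfl, rfl, rfl⟩ := hx
  by_cases hr : ∃ r : X ⟶ B, i ≫ r = 𝟙 B
  · obtain ⟨r, hr⟩ := hr
    exact .inl (IsoClass.mk_eq_mk_iff.2 (E.nonempty_iso_biprod_of_retraction h r hr))
  right
  change (IsoClass.mk X).endCard < (IsoClass.mk A + IsoClass.mk B).endCard
  rw [IsoClass.mk_add_mk, IsoClass.endCard_mk, IsoClass.endCard_mk, card_biprod_end]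
  have hlt : Nat.card (X ⟶ B) < Nat.card (A ⟶ B) * Nat.card (B ⟶ B) := by
    rw [E.card_hom_from_eq h B]
    refine Nat.mul_lt_mul_of_pos_left ?_ Nat.card_pos
    refine lt_of_le_of_ne (Nat.card_le_card_of_injective _ Subtype.val_injective) fun heq => hr ?_
    have htop := AddSubgroup.eq_top_of_card_eq _ heq
    have : 𝟙 B ∈ (Preadditive.leftComp B i).range := htop ▸ AddSubgroup.mem_top _
    exact this
  have hpos : 0 < Nat.card (A ⟶ A) * Nat.card (B ⟶ A) := Nat.mul_pos Nat.card_pos Nat.card_pos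
  exact (E.card_hom_to_le hfin h X).trans_lt
    (Nat.mul_lt_mul_of_le_of_lt (E.card_hom_from_le hfin h A) hlt hpos)

end EndCard

end ExactStructure

/-- Orthogonal projection to a finite-dimensional subspace on which a form is anisotropic. -/
theorem LinearMap.exists_sub_orthogonal {K V : Type*} [Field K] [AddCommGroup V] [Module K V]
    (B : V →ₗ[K] V →ₗ[K] K) (W : Submodule K V) [FiniteDimensional K W]
    (hB : ∀ w ∈ W, B w w = 0 → w = 0) (v : V) : ∃ w ∈ W, ∀ u ∈ W, B (v - w) u = 0 := by
  let φ : W →ₗ[K] Module.Dual K W := B.domRestrict₁₂ W W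
  have hinj : Function.Injective φ := by
    rw [injective_iff_map_eq_zero]
    intro w hw
    have : B w w = 0 := LinearMap.congr_fun hw w
    exact Subtype.ext (hB w w.2 this)
  -- An injection of `W` into its dual is onto by dimension, so the restriction of `B v` to `W` is
  -- represented by some `w`. Symmetry of `B` plays no role.
  obtain ⟨w, hw⟩ := (LinearMap.injective_iff_surjective_of_finrank_eq_finrank
    (Subspace.dual_finrank_eq (K := K) (V := W)).symm).1 hinj ((B v).domRestrict W)
  refine ⟨w, w.2, fun u hu => ?_⟩
  have h : B w u = B v u := LinearMap.congr_fun hw ⟨u, hu⟩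
  rw [map_sub, LinearMap.sub_apply, h, sub_self]

/-! ### Green's form, the algebra laws, and primitivity as orthogonality -/

namespace ExactStructure

variable {C : Type u} [Category.{v} C] [Preadditive C]

/-- Green's form on the Hall algebra: `⟨[A], [B]⟩ = δ / #Aut A`. -/
noncomputable def greenForm (C : Type u) [Category.{v} C] :
    HallAlgebra C →ₗ[ℚ] HallAlgebra C →ₗ[ℚ] ℚ :=
  Finsupp.linearCombination ℚ fun a => ((a.autCard : ℚ)⁻¹ • Finsupp.lapply a)

theorem greenForm_apply (v w : HallAlgebra C) :
    greenForm C v w = v.sum fun a r => r * ((a.autCard : ℚ)⁻¹ * w a) := by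
  rw [greenForm, Finsupp.linearCombination_apply, Finsupp.sum, LinearMap.sum_apply]
  rfl

/-- On the diagonal the form is a sum of rational squares with positive weights. -/
theorem greenForm_self_eq_zero (hfin : ∀ X Y : C, Finite (X ⟶ Y)) {v : HallAlgebra C}
    (h : greenForm C v v = 0) : v = 0 := by
  have pos : ∀ x : IsoClass C, 0 < (x.autCard : ℚ)⁻¹ := fun x =>
    inv_pos.2 (by exact_mod_cast IsoClass.autCard_pos hfin x)
  have hnn : ∀ a ∈ v.support, 0 ≤ v a * ((a.autCard : ℚ)⁻¹ * v a) := fun a _ => by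
    rw [mul_left_comm]
    exact mul_nonneg (pos a).le (mul_self_nonneg _)
  rw [greenForm_apply, Finsupp.sum, Finset.sum_eq_zero_iff_of_nonneg hnn] at h
  ext a
  by_contra ha
  have := h a (Finsupp.mem_support_iff.2 ha)
  simp only [mul_eq_zero, (pos a).ne', false_or, or_self] at this
  exact ha this

variable [HasZeroObject C] [HasBinaryBiproducts C] {E : ExactStructure C}

theorem IsFinitary.basisMul_apply (h : E.IsFinitary) (a b x : IsoClass C) :
    h.basisMul a b x = E.hallNumber a b x := rfl

theorem IsFinitary.mul_hallBasis (h : E.IsFinitary) (a b : IsoClass C) :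
    h.mul (hallBasis a) (hallBasis b) = h.basisMul a b := by
  simp [IsFinitary.mul]

theorem IsFinitary.mem_support_basisMul (h : E.IsFinitary) {a b x : IsoClass C} :
    x ∈ (h.basisMul a b).support ↔ x ∈ E.extClasses a b := by
  rw [Finsupp.mem_support_iff, h.basisMul_apply, Nat.cast_ne_zero,
    E.hallNumber_ne_zero_iff h.finite_hom]

theorem IsFinitary.one_mul (h : E.IsFinitary) (v : HallAlgebra C) : h.mul (hallBasis 0) v = v := by
  induction v using Finsupp.induction_linear with
  | zero => simp
  | add v w hv hw => rw [map_add, hv, hw]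
  | single a r =>
    classical
    rw [← mul_one r, ← smul_eq_mul, ← Finsupp.smul_single, map_smul, h.mul_hallBasis]
    congr 1
    ext x
    rw [h.basisMul_apply, E.hallNumber_zero_left h.finite_hom, Finsupp.single_apply]
    simp [eq_comm]

theorem IsFinitary.mul_one (h : E.IsFinitary) (v : HallAlgebra C) : h.mul v (hallBasis 0) = v := by
  induction v using Finsupp.induction_linear with
  | zero => simp
  | add v w hv hw => rw [map_add, LinearMap.add_apply, hv, hw]
  | single a r =>
    classical
    rw [← _root_.mul_one r, ← smul_eq_mul, ← Finsupp.smul_single, map_smul, LinearMap.smul_apply,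
      h.mul_hallBasis]
    congr 1
    ext x
    rw [h.basisMul_apply, E.hallNumber_zero_right h.finite_hom, Finsupp.single_apply]
    simp [eq_comm]

theorem IsFinitary.mul_hallBasis_right_apply (h : E.IsFinitary) (v : HallAlgebra C)
    (d y : IsoClass C) :
    h.mul v (hallBasis d) y = ∑ x ∈ v.support, v x * (E.hallNumber x d y : ℚ) := by
  rw [IsFinitary.mul, Finsupp.linearCombination_apply, Finsupp.sum, LinearMap.sum_apply,
    Finsupp.finsetSum_apply]
  refine Finset.sum_congr rfl fun x _ => ?_
  simp [h.basisMul_apply]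

theorem IsFinitary.mul_hallBasis_left_apply (h : E.IsFinitary) (v : HallAlgebra C)
    (a y : IsoClass C) :
    h.mul (hallBasis a) v y = ∑ x ∈ v.support, v x * (E.hallNumber a x y : ℚ) := by
  rw [IsFinitary.mul, Finsupp.linearCombination_single, one_smul, Finsupp.linearCombination_apply,
    Finsupp.sum, Finsupp.finsetSum_apply]
  refine Finset.sum_congr rfl fun x _ => ?_
  simp [h.basisMul_apply]

theorem IsFinitary.mul_assoc (h : E.IsFinitary) (u v w : HallAlgebra C) :
    h.mul (h.mul u v) w = h.mul u (h.mul v w) := by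
  induction u using Finsupp.induction_linear with
  | zero => simp
  | add u u' hu hu' => simp only [map_add, LinearMap.add_apply, hu, hu']
  | single a r =>
  induction v using Finsupp.induction_linear with
  | zero => simp
  | add v v' hv hv' => simp only [map_add, LinearMap.add_apply, hv, hv']
  | single b s =>
  induction w using Finsupp.induction_linear with
  | zero => simp
  | add w w' hw hw' => simp only [map_add, hw, hw']
  | single d t =>
  have key : h.mul (h.mul (hallBasis a) (hallBasis b)) (hallBasis d) =
      h.mul (hallBasis a) (h.mul (hallBasis b) (hallBasis d)) := by
    ext y
    rw [h.mul_hallBasis_right_apply, h.mul_hallBasis_left_apply, h.mul_hallBasis, h.mul_hallBasis]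
    refine E.sum_hallNumber_mul h.finite_hom a b d y _ _ (fun x => ?_) (fun x => ?_) <;>
      rw [h.mem_support_basisMul, E.hallNumber_ne_zero_iff h.finite_hom]
  have hs : ∀ (x : IsoClass C) (r : ℚ), Finsupp.single x r = r • hallBasis x := by simp
  rw [hs a, hs b, hs d]
  simp only [map_smul, LinearMap.smul_apply, key]

/-- The product pairs with the coproduct under Green's form. -/
theorem IsCofinitary.comul_apply (hC : E.IsCofinitary) (h : E.IsFinitary) (v : HallAlgebra C)
    (a b : IsoClass C) : finsuppTensorFinsupp' ℚ _ _ (hC.comul v) (a, b) =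
      a.autCard * b.autCard * greenForm C v (h.mul (hallBasis b) (hallBasis a)) := by
  have hc : ∀ c, finsuppTensorFinsupp' ℚ (IsoClass C) (IsoClass C)
      ((hC.coeff c).sum fun p r => r • (hallBasis p.1 ⊗ₜ[ℚ] hallBasis p.2)) = hC.coeff c := by
    intro c
    rw [map_finsuppSum]
    simp only [map_smul, finsuppTensorFinsupp'_single_tmul_single, _root_.mul_one,
      Finsupp.smul_single, smul_eq_mul]
    exact Finsupp.sum_single _
  rw [IsCofinitary.comul, Finsupp.linearCombination_apply, map_finsuppSum, greenForm_apply,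
    Finsupp.sum, Finsupp.finsetSum_apply, Finsupp.mul_sum, h.mul_hallBasis]
  refine Finset.sum_congr rfl fun c _ => ?_
  rw [map_smul, hc, Finsupp.smul_apply, smul_eq_mul]
  -- The denominator `#Aut c` of the dual Hall number is the weight of Green's form at `c`, and the
  -- interchange of `a` and `b` in its definition causes the reversed product.
  change v c * E.dualHallNumber a b c =
    a.autCard * b.autCard * (v c * ((c.autCard : ℚ)⁻¹ * E.hallNumber b a c))
  rw [dualHallNumber]
  push_cast
  ring

/-- Compare coefficients of `[a] ⊗ [b]`. For `a, b ≠ 0` the right side of the primitivity equation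
vanishes, which gives orthogonality; if `a` or `b` is zero, the unit laws leave only the condition
`v 0 = 0`. -/
theorem IsCofinitary.mem_prim_iff (hC : E.IsCofinitary) (h : E.IsFinitary) {v : HallAlgebra C} :
    v ∈ hC.prim ↔ v 0 = 0 ∧ ∀ m n : IsoClass C, m ≠ 0 → n ≠ 0 →
      greenForm C v (h.mul (hallBasis m) (hallBasis n)) = 0 := by
  classical
  have pos : ∀ x : IsoClass C, (x.autCard : ℚ) ≠ 0 := fun x => by
    exact_mod_cast (IsoClass.autCard_pos h.finite_hom x).ne'
  have hform : ∀ a, greenForm C v (hallBasis a) = (a.autCard : ℚ)⁻¹ * v a := by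
    intro a
    rw [greenForm_apply, Finsupp.sum_eq_single a]
    · simp [mul_comm]
    · intro b _ hb
      simp [hb.symm]
    · simp
  have key : v ∈ hC.prim ↔ ∀ a b : IsoClass C,
      a.autCard * b.autCard * greenForm C v (h.mul (hallBasis b) (hallBasis a)) =
        v a * (hallBasis 0 : HallAlgebra C) b + (hallBasis 0 : HallAlgebra C) a * v b := by
    change hC.comul v = _ ↔ _
    rw [← (finsuppTensorFinsupp' ℚ (IsoClass C) (IsoClass C)).injective.eq_iff, DFunLike.ext_iff,
      Prod.forall]
    simp only [hC.comul_apply h, map_add, Finsupp.add_apply, finsuppTensorFinsupp'_apply_apply]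
  rw [key]
  constructor
  · intro hv
    constructor
    -- The coefficient at `(0, 0)` reads `v 0 = v 0 + v 0`.
    · have := hv 0 0
      rw [h.one_mul, hform, IsoClass.autCard_zero, Finsupp.single_eq_same] at this
      norm_num at this
      linarith
    · intro m n hm hn
      have := hv n m
      rw [Finsupp.single_eq_of_ne hm, Finsupp.single_eq_of_ne hn] at this
      simpa [pos] using this
  · rintro ⟨h0, hv⟩ a b
    by_cases ha : a = 0
    · subst ha
      rw [h.mul_one, hform, IsoClass.autCard_zero, Finsupp.single_eq_same, h0]
      have := pos b
      field_simp
      simp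
    by_cases hb : b = 0
    · subst hb
      rw [h.one_mul, hform, IsoClass.autCard_zero, Finsupp.single_eq_same, h0]
      have := pos a
      field_simp
      simp
    rw [hv b a hb ha, Finsupp.single_eq_of_ne ha, Finsupp.single_eq_of_ne hb]
    simp

end ExactStructure

/-! ### The augmentation ideal and powers of subspaces -/

namespace ExactStructure

variable {C : Type u} [Category.{v} C] [Preadditive C] [HasZeroObject C] [HasBinaryBiproducts C]
  {E : ExactStructure C}

theorem ker_counit_eq_span : LinearMap.ker (counit : HallAlgebra C →ₗ[ℚ] ℚ) =
    Submodule.span ℚ (hallBasis '' {x : IsoClass C | x ≠ 0}) := by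
  apply le_antisymm
  · intro v hv
    have hv : v 0 = 0 := hv
    rw [← Finsupp.sum_single v]
    refine Submodule.sum_mem _ fun x hx => ?_
    rw [← mul_one (v x), ← smul_eq_mul, ← Finsupp.smul_single]
    refine Submodule.smul_mem _ _ (Submodule.subset_span ⟨x, ?_, rfl⟩)
    rintro rfl
    exact Finsupp.mem_support_iff.1 hx hv
  · rw [Submodule.span_le]
    rintro _ ⟨x, hx, rfl⟩
    exact Finsupp.single_eq_of_ne hx.symm

theorem IsFinitary.decomposables_eq_span (h : E.IsFinitary) :
    h.decomposables = Submodule.span ℚ {z | ∃ m n : IsoClass C, m ≠ 0 ∧ n ≠ 0 ∧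
      z = h.mul (hallBasis m) (hallBasis n)} := by
  rw [IsFinitary.decomposables, ker_counit_eq_span, Submodule.map₂_span_span]
  congr 1
  ext z
  constructor
  · rintro ⟨_, ⟨m, hm, rfl⟩, _, ⟨n, hn, rfl⟩, rfl⟩
    exact ⟨m, n, hm, hn, rfl⟩
  · rintro ⟨m, n, hm, hn, rfl⟩
    exact ⟨_, ⟨m, hm, rfl⟩, _, ⟨n, hn, rfl⟩, rfl⟩

theorem IsFinitary.decomposables_le_ker_counit (h : E.IsFinitary) :
    h.decomposables ≤ LinearMap.ker counit := by
  rw [h.decomposables_eq_span, Submodule.span_le]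
  rintro _ ⟨m, n, hm, hn, rfl⟩
  change h.mul _ _ 0 = 0
  rw [h.mul_hallBasis]
  by_contra h0
  exact hm (E.eq_zero_of_zero_mem_extClasses
    (h.mem_support_basisMul.1 (Finsupp.mem_support_iff.2 h0))).1

theorem IsFinitary.pow_one (h : E.IsFinitary) (V : Submodule ℚ (HallAlgebra C)) :
    h.pow V 1 = V := by
  change Submodule.map₂ h.mul (Submodule.span ℚ {hallBasis 0}) V = V
  rw [Submodule.map₂_span_singleton_eq_map]
  ext v
  simp [h.one_mul]

theorem IsFinitary.map₂_pow_le (h : E.IsFinitary) (V : Submodule ℚ (HallAlgebra C)) (k l : ℕ) :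
    Submodule.map₂ h.mul (h.pow V k) (h.pow V l) ≤ h.pow V (k + l) := by
  induction l with
  | zero =>
    change Submodule.map₂ h.mul _ (Submodule.span ℚ {hallBasis 0}) ≤ h.pow V k
    rw [Submodule.map₂_span_singleton_eq_map_flip]
    rintro _ ⟨v, hv, rfl⟩
    simpa [h.mul_one] using hv
  | succ l ih =>
    rw [Submodule.map₂_le]
    intro u hu w hw
    change w ∈ Submodule.map₂ h.mul (h.pow V l) V at hw
    rw [Submodule.map₂_eq_span_image2] at hw
    induction hw using Submodule.span_induction with
    | mem w hw =>
      obtain ⟨x, hx, y, hy, rfl⟩ := hw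
      dsimp only
      rw [← h.mul_assoc]
      exact Submodule.apply_mem_map₂ h.mul (ih (Submodule.apply_mem_map₂ _ hu hx)) hy
    | zero => simp
    | add x y _ _ hx hy => rw [map_add]; exact Submodule.add_mem _ hx hy
    | smul r x _ hx => rw [map_smul]; exact Submodule.smul_mem _ _ hx

/-- The span of all products of at least `n` elements of `V`. -/
noncomputable def IsFinitary.powersFrom (h : E.IsFinitary) (V : Submodule ℚ (HallAlgebra C))
    (n : ℕ) : Submodule ℚ (HallAlgebra C) :=
  ⨆ (k : ℕ) (_ : n ≤ k), h.pow V k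

theorem IsFinitary.pow_le_powersFrom (h : E.IsFinitary) (V : Submodule ℚ (HallAlgebra C))
    {n k : ℕ} (hk : n ≤ k) : h.pow V k ≤ h.powersFrom V n :=
  le_iSup₂_of_le k hk le_rfl

theorem IsFinitary.le_powersFrom_one (h : E.IsFinitary) (V : Submodule ℚ (HallAlgebra C)) :
    V ≤ h.powersFrom V 1 :=
  (h.pow_one V).symm.le.trans (h.pow_le_powersFrom V le_rfl)

theorem IsFinitary.powersFrom_two_le (h : E.IsFinitary) (V : Submodule ℚ (HallAlgebra C)) :
    h.powersFrom V 2 ≤ h.powersFrom V 1 :=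
  iSup₂_le fun _ hk => h.pow_le_powersFrom V (by omega)

theorem IsFinitary.map₂_powersFrom_one_le (h : E.IsFinitary)
    (V : Submodule ℚ (HallAlgebra C)) :
    Submodule.map₂ h.mul (h.powersFrom V 1) (h.powersFrom V 1) ≤ h.powersFrom V 2 := by
  simp only [IsFinitary.powersFrom, Submodule.map₂_iSup_left, Submodule.map₂_iSup_right]
  refine iSup₂_le fun k hk => iSup₂_le fun l hl => (h.map₂_pow_le V _ _).trans ?_
  exact h.pow_le_powersFrom V (by omega)

/-- If every element of `ker ε` is a combination of products of one or more elements of `V`, a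
product of two of them uses at least two factors. Conversely, a product of `k + 1 ≥ 2` elements of
`V` splits off its last factor, and both pieces lie in `ker ε`. -/
theorem IsFinitary.decomposables_eq_powersFrom_two (h : E.IsFinitary)
    {V : Submodule ℚ (HallAlgebra C)} (hV : V ≤ LinearMap.ker counit)
    (hgen : LinearMap.ker counit ≤ h.powersFrom V 1) :
    h.decomposables = h.powersFrom V 2 := by
  apply le_antisymm
  · exact (Submodule.map₂_le_map₂ hgen hgen).trans (h.map₂_powersFrom_one_le V)
  · have hpow : ∀ k, 1 ≤ k → h.pow V k ≤ LinearMap.ker counit := by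
      intro k hk
      induction k, hk using Nat.le_induction with
      | base => rwa [h.pow_one]
      | succ k _ ih =>
        exact (Submodule.map₂_le_map₂ ih hV).trans h.decomposables_le_ker_counit
    refine iSup₂_le fun k hk => ?_
    obtain ⟨k, rfl⟩ : ∃ l, k = l + 1 := ⟨k - 1, by omega⟩
    exact Submodule.map₂_le_map₂ (hpow k (by omega)) hV

/-! ### Generation by indecomposables -/

section Indecomposables

theorem indSpan_le_ker_counit : indSpan C ≤ LinearMap.ker counit := by
  rw [ker_counit_eq_span]
  refine Submodule.span_mono (Set.image_mono ?_)
  rintro _ ⟨X, hX, rfl⟩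
  exact fun h => hX.1 (IsoClass.mk_eq_zero_iff.1 h)

theorem mem_indClasses_or_exists_add (x : IsoClass C) (hx : x ≠ 0) :
    x ∈ indClasses C ∨ ∃ m n : IsoClass C, m ≠ 0 ∧ n ≠ 0 ∧ x = m + n := by
  obtain ⟨X, rfl⟩ := IsoClass.exists_mk x
  by_cases hX : Indecomposable X
  · exact .inl ⟨X, hX, rfl⟩
  right
  have hX0 : ¬IsZero X := fun h => hx (IsoClass.mk_eq_zero_iff.2 h)
  simp only [Indecomposable, hX0, not_false_eq_true, true_and, not_forall, not_or] at hX
  obtain ⟨Y, Z, e, hY, hZ⟩ := hX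
  exact ⟨.mk Y, .mk Z, fun h => hY (IsoClass.mk_eq_zero_iff.1 h),
    fun h => hZ (IsoClass.mk_eq_zero_iff.1 h), IsoClass.mk_eq_mk_iff.2 ⟨e⟩⟩

/-- The triangularity step: an element with all but one of its terms in `S` has the last one there
too. -/
theorem hallBasis_mem_of_forall_ne {S : Submodule ℚ (HallAlgebra C)} {f : HallAlgebra C}
    (hf : f ∈ S) {x : IsoClass C} (hx : f x ≠ 0)
    (h : ∀ y ∈ f.support, y ≠ x → hallBasis y ∈ S) : hallBasis x ∈ S := by
  classical
  have hsingle : f x • (hallBasis x : HallAlgebra C) ∈ S := by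
    have : f x • (hallBasis x : HallAlgebra C) = f - ∑ y ∈ f.support.erase x, f y • hallBasis y := by
      rw [eq_sub_iff_add_eq, Finset.add_sum_erase _ (fun y => f y • (hallBasis y : HallAlgebra C))
        (Finsupp.mem_support_iff.2 hx)]
      simp only [Finsupp.smul_single, smul_eq_mul, mul_one]
      exact Finsupp.sum_single f
    rw [this]
    refine Submodule.sub_mem _ hf (Submodule.sum_mem _ fun y hy => Submodule.smul_mem _ _ ?_)
    exact h y (Finset.mem_of_mem_erase hy) (Finset.ne_of_mem_erase hy)
  exact (Submodule.smul_mem_iff _ hx).1 hsingle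

/-- Strong induction on `#End`. If `x = m + n` is decomposable, then `m`, `n` and every term of `[m]
· [n]` other than `[x]` have fewer endomorphisms, so `[x]` can be solved for. -/
theorem IsFinitary.hallBasis_mem_powersFrom_indSpan (h : E.IsFinitary) (n : ℕ) (x : IsoClass C)
    (hx : x ≠ 0) (hn : x.endCard = n) : hallBasis x ∈ h.powersFrom (indSpan C) 1 := by
  induction n using Nat.strong_induction_on generalizing x with
  | _ N ih =>
  subst hn
  obtain hX | ⟨m, n, hm, hn, rfl⟩ := mem_indClasses_or_exists_add x hx
  · exact h.le_powersFrom_one _ (Submodule.subset_span ⟨x, hX, rfl⟩)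
  have hm' := ih _ (IsoClass.endCard_lt_add h.finite_hom m hn) m hm rfl
  have hn' := ih _ (add_comm m n ▸ IsoClass.endCard_lt_add h.finite_hom n hm) n hn rfl
  have hmn := h.powersFrom_two_le _
    (h.map₂_powersFrom_one_le _ (Submodule.apply_mem_map₂ h.mul hm' hn'))
  rw [h.mul_hallBasis] at hmn
  refine hallBasis_mem_of_forall_ne hmn
    (Finsupp.mem_support_iff.1 (h.mem_support_basisMul.2 (E.add_mem_extClasses m n)))
    fun y hy hne => ?_
  have hy := h.mem_support_basisMul.1 hy
  refine ih _ ((E.eq_add_or_endCard_lt h.finite_hom hy).resolve_left hne) y ?_ rfl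
  rintro rfl
  exact hm (E.eq_zero_of_zero_mem_extClasses hy).1

theorem IsFinitary.ker_counit_le_powersFrom_indSpan (h : E.IsFinitary) :
    LinearMap.ker counit ≤ h.powersFrom (indSpan C) 1 := by
  rw [ker_counit_eq_span, Submodule.span_le]
  rintro _ ⟨x, hx, rfl⟩
  exact h.hallBasis_mem_powersFrom_indSpan _ x hx rfl

end Indecomposables

/-! ### Orthogonal decomposition and generation by primitives -/

section Primitives

theorem homogeneous_le_ker_counit {γ : E.GrothendieckMonoid} (hγ : γ ≠ 0) :
    E.homogeneous γ ≤ LinearMap.ker counit := by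
  rw [ker_counit_eq_span]
  refine Submodule.span_mono (Set.image_mono ?_)
  rintro x hx rfl
  exact hγ (by rw [← hx, map_zero])

theorem mem_homogeneous_iff {γ : E.GrothendieckMonoid} {v : HallAlgebra C} :
    v ∈ E.homogeneous γ ↔ ∀ x ∈ v.support, E.grothendieckClass x = γ := by
  have : E.homogeneous γ = Finsupp.supported ℚ ℚ {x | E.grothendieckClass x = γ} :=
    (Finsupp.supported_eq_span_single ℚ _).symm
  rw [this, Finsupp.mem_supported]
  rfl

theorem greenForm_eq_zero_of_disjoint {v w : HallAlgebra C}
    (h : ∀ x ∈ v.support, w x = 0) : greenForm C v w = 0 := by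
  rw [greenForm_apply]
  exact Finset.sum_eq_zero fun x hx => by simp [h x hx]

/-- The span of all `[M] · [N]` with `M, N ≠ 0` and `|M| + |N| = γ`. -/
noncomputable def IsFinitary.homogeneousDecomposables (h : E.IsFinitary)
    (γ : E.GrothendieckMonoid) : Submodule ℚ (HallAlgebra C) :=
  Submodule.span ℚ {z | ∃ m n : IsoClass C, m ≠ 0 ∧ n ≠ 0 ∧
    E.grothendieckClass m + E.grothendieckClass n = γ ∧ z = h.mul (hallBasis m) (hallBasis n)}

theorem IsFinitary.mul_mem_homogeneous (h : E.IsFinitary) (m n : IsoClass C) :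
    h.mul (hallBasis m) (hallBasis n) ∈
      E.homogeneous (E.grothendieckClass m + E.grothendieckClass n) := by
  rw [mem_homogeneous_iff, h.mul_hallBasis]
  exact fun x hx => E.grothendieckClass_of_mem_extClasses (h.mem_support_basisMul.1 hx)

theorem IsFinitary.homogeneousDecomposables_le (h : E.IsFinitary) (γ : E.GrothendieckMonoid) :
    h.homogeneousDecomposables γ ≤ h.decomposables ⊓ E.homogeneous γ := by
  rw [IsFinitary.homogeneousDecomposables, Submodule.span_le]
  rintro _ ⟨m, n, hm, hn, rfl, rfl⟩
  refine ⟨?_, h.mul_mem_homogeneous m n⟩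
  rw [h.decomposables_eq_span]
  exact Submodule.subset_span ⟨m, n, hm, hn, rfl⟩

theorem IsCofinitary.prim_le_ker_counit (hC : E.IsCofinitary) (h : E.IsFinitary) :
    hC.prim ≤ LinearMap.ker counit :=
  fun _ hv => ((hC.mem_prim_iff h).1 hv).1

/-- A primitive element is orthogonal to `P`; if it also lies in `P` it is orthogonal to itself, and
the form is anisotropic. -/
theorem IsCofinitary.disjoint_prim_decomposables (hC : E.IsCofinitary) (h : E.IsFinitary) :
    Disjoint hC.prim h.decomposables := by
  rw [Submodule.disjoint_def]
  intro v hv hv'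
  refine greenForm_self_eq_zero h.finite_hom ?_
  have : h.decomposables ≤ LinearMap.ker (greenForm C v) := by
    rw [h.decomposables_eq_span, Submodule.span_le]
    rintro _ ⟨m, n, hm, hn, rfl⟩
    exact ((hC.mem_prim_iff h).1 hv).2 m n hm hn
  exact this hv'

/-- Subtract from `v` its orthogonal projection to the products of degree `γ`, a finite-dimensional
space by profinitarity. Retaining the degrees of the factors is what the later induction requires.
-/
theorem homogeneous_le_prim_sup (hP : E.IsProfinitary) (hC : E.IsCofinitary)
    {γ : E.GrothendieckMonoid} (hγ : γ ≠ 0) : E.homogeneous γ ≤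
      (hC.prim ⊓ E.homogeneous γ) ⊔ hP.isFinitary.homogeneousDecomposables γ := by
  intro v hv
  have hle := (hP.isFinitary.homogeneousDecomposables_le γ).trans inf_le_right
  have hfd : FiniteDimensional ℚ (E.homogeneous γ) :=
    FiniteDimensional.span_of_finite ℚ ((hP.finite_class γ).image _)
  have := Submodule.finiteDimensional_of_le hle
  obtain ⟨w, hw, horth⟩ := (greenForm C).exists_sub_orthogonal
    (hP.isFinitary.homogeneousDecomposables γ)
    (fun w _ => greenForm_self_eq_zero hP.finite_hom) v
  have hvw : v - w ∈ E.homogeneous γ := Submodule.sub_mem _ hv (hle hw)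
  rw [← sub_add_cancel v w]
  refine Submodule.add_mem_sup ⟨(hC.mem_prim_iff hP.isFinitary).2
    ⟨homogeneous_le_ker_counit hγ hvw, fun m n hm hn => ?_⟩, hvw⟩ hw
  by_cases hmn : E.grothendieckClass m + E.grothendieckClass n = γ
  · exact horth _ (Submodule.subset_span ⟨m, n, hm, hn, hmn, rfl⟩)
  -- Products of another degree have support disjoint from that of `v - w`, so orthogonality to them
  -- is automatic.
  · refine greenForm_eq_zero_of_disjoint fun x hx => ?_
    by_contra hx'
    exact hmn ((mem_homogeneous_iff.1 (hP.isFinitary.mul_mem_homogeneous m n) x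
      (Finsupp.mem_support_iff.2 hx')).symm.trans (mem_homogeneous_iff.1 hvw x hx))

/-- Induction on a bound for `#End` over the whole class `γ`, since the orthogonal decomposition
acts on all of `H_γ` and not on a single object. If `γ = |m| + |n|` with `m, n ≠ 0`, the bounds for
`|m|` and `|n|` are smaller. -/
theorem homogeneous_le_powersFrom_prim (hP : E.IsProfinitary) (hC : E.IsCofinitary) (N : ℕ)
    (γ : E.GrothendieckMonoid) (hγ : γ ≠ 0)
    (hN : ∀ x, E.grothendieckClass x = γ → x.endCard < N) :
    E.homogeneous γ ≤ hP.isFinitary.powersFrom hC.prim 1 := by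
  induction N generalizing γ with
  | zero =>
    -- Every Grothendieck class contains an object, so the bound `0` is impossible.
    obtain ⟨x, rfl⟩ := AddCon.mk'_surjective γ
    exact absurd (hN x rfl) (Nat.not_lt_zero _)
  | succ N ih =>
  refine (homogeneous_le_prim_sup hP hC hγ).trans (sup_le ?_ ?_)
  · exact inf_le_left.trans (hP.isFinitary.le_powersFrom_one _)
  rw [IsFinitary.homogeneousDecomposables, Submodule.span_le]
  rintro _ ⟨m, n, hm, hn, rfl, rfl⟩
  have key : ∀ m n : IsoClass C, m ≠ 0 → n ≠ 0 →
      (∀ x, E.grothendieckClass x = E.grothendieckClass m + E.grothendieckClass n →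
        x.endCard < N + 1) → hallBasis m ∈ hP.isFinitary.powersFrom hC.prim 1 := by
    intro m n hm hn hmn
    refine ih (E.grothendieckClass m) (fun h => hm (E.grothendieckClass_eq_zero_iff.1 h))
      (fun x hx => ?_) (Submodule.subset_span ⟨m, rfl, rfl⟩)
    -- For any `x` in the class of `m`, the sum `x + n` lies in the original class and has strictly
    -- more endomorphisms than `x`.
    have h₁ := hmn (x + n) (by rw [map_add, hx])
    have h₂ := IsoClass.endCard_lt_add hP.finite_hom x hn
    omega
  exact hP.isFinitary.powersFrom_two_le _ (hP.isFinitary.map₂_powersFrom_one_le _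
    (Submodule.apply_mem_map₂ _ (key m n hm hn hN)
      (key n m hn hm fun x hx => hN x (hx.trans (add_comm _ _)))))

theorem ker_counit_le_powersFrom_prim (hP : E.IsProfinitary) (hC : E.IsCofinitary) :
    LinearMap.ker counit ≤ hP.isFinitary.powersFrom hC.prim 1 := by
  rw [ker_counit_eq_span, Submodule.span_le]
  rintro _ ⟨x, hx, rfl⟩
  obtain ⟨N, hN⟩ := ((hP.finite_class (E.grothendieckClass x)).image IsoClass.endCard).bddAbove
  exact homogeneous_le_powersFrom_prim hP hC (N + 1) (E.grothendieckClass x)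
    (fun h => hx (E.grothendieckClass_eq_zero_iff.1 h))
    (fun y hy => Nat.lt_succ_of_le (hN ⟨y, hy, rfl⟩)) (Submodule.subset_span ⟨x, rfl, rfl⟩)

end Primitives

end ExactStructure

theorem mainTheorem8 {C : Type u} [Category.{v} C] [Preadditive C] [HasZeroObject C]
    [HasBinaryBiproducts C] (E : ExactStructure C)
    (hP : E.IsProfinitary) (hC : E.IsCofinitary) :
    hP.isFinitary.decomposables = Submodule.span ℚ {z | ∃ m n : IsoClass C, m ≠ 0 ∧ n ≠ 0 ∧
        z = hP.isFinitary.mul (ExactStructure.hallBasis m) (ExactStructure.hallBasis n)} ∧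
    hP.isFinitary.decomposables = ⨆ (k : ℕ) (_ : 2 ≤ k), hP.isFinitary.pow hC.prim k ∧
    hP.isFinitary.decomposables =
      ⨆ (k : ℕ) (_ : 2 ≤ k), hP.isFinitary.pow (ExactStructure.indSpan C) k ∧
    ∀ γ : E.GrothendieckMonoid, γ ≠ 0 →
      Disjoint (hC.prim ⊓ E.homogeneous γ) (hP.isFinitary.decomposables ⊓ E.homogeneous γ) ∧
      (hC.prim ⊓ E.homogeneous γ) ⊔ (hP.isFinitary.decomposables ⊓ E.homogeneous γ) =
        E.homogeneous γ := by
  have h := hP.isFinitary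
  refine ⟨h.decomposables_eq_span,
    h.decomposables_eq_powersFrom_two (hC.prim_le_ker_counit h)
      (ExactStructure.ker_counit_le_powersFrom_prim hP hC),
    h.decomposables_eq_powersFrom_two ExactStructure.indSpan_le_ker_counit
      h.ker_counit_le_powersFrom_indSpan,
    fun γ hγ => ⟨(hC.disjoint_prim_decomposables h).mono inf_le_left inf_le_left,
      le_antisymm (sup_le inf_le_right inf_le_right) ?_⟩⟩
  -- The products of degree `γ` need only lie in `P_γ`; that they span it is not used.
  exact (ExactStructure.homogeneous_le_prim_sup hP hC hγ).trans
    (sup_le_sup_left (h.homogeneousDecomposables_le γ) _)
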